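/- Let $s\in\mathbb N$, $\alpha\in\mathbb N_0=\{0,1,2,\dots\}$, $0<\lambda\le 1$, and let $f:[0,1]^s\to\mathbb R$. *Norm.* For $2\le p\le\infty$ with $p>1/\lambda$, say that $g:[0,1]^s\to\mathbb R$ belongs to $\mathcal H_{\lambda,s,p}$ if there are functions $D_u^\lambda g\in L^p([0,1]^{|u|})$, $u\subseteq\{1,\dots,s\}$ (with $D^\lambda_\emptyset g$ a real number), such that for all $x\in[0,1]^s$ $$g(x)=\sum_{u\subseteq\{1,\dots,s\}}\Gamma(\lambda)^{-|u|}\int_{[0,1]^{|u|}}D_u^\lambda g(t_u)\prod_{j\in u}(x_j-t_j)_+^{\lambda-1}\,\mathrm dt_u,$$ where $(x_j-t_j)_+^{\lambda-1}$ means $(x_j-t_j)^{\lambda-1}$ if $x_j>t_j$ and $0$ otherwise. The functions $D^\lambda_u g$ are then unique almost everywhere; put $\|g\|_{\lambda,s}=\bigl(\sum_{u}\|D_u^\lambda g\|^2_{L^2([0,1]^{|u|})}\bigr)^{1/2}$. Define $$\|f\|_{\alpha,\lambda}=\Bigl(\sum_{a\in\{0,\dots,\alpha\}^s}\|f^{(a)}\|_{\lambda,s}^2\Bigr)^{1/2},\qquad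 f^{(a)}=\frac{\partial^{a_1+\dots+a_s}f}{\partial x_1^{a_1}\cdots\partial x_s^{a_s}}.$$ Here $\|f\|_{\alpha,\lambda}<\infty$ means that all these mixed derivatives exist on $[0,1]^s$ (one-sided at the boundary) and that each belongs to $\mathcal H_{\lambda,s,p}$ for some $p\ge 2$ with $p>1/\lambda$. *Walsh coefficients.* For $k=\sum_{l\ge1}a_l2^{l-1}\in\mathbb N_0$ with $a_l\in\{0,1\}$, let $\kappa=\{l\ge 1: a_l=1\}$, and let $\lceil\kappa\rceil_q$ be the $q$-th largest element of $\kappa$, or $0$ if $q>|\kappa|$. Let $\mathrm{wal}_k(x)=(-1)^{\sum_{l\in\kappa}x_l}$ for $x=\sum_{l\ge1}x_l2^{-l}\in[0,1)$, where the binary expansion with finitely many ones is chosen if there are two. For $k=(k_1,\dots,k_s)\in\mathbb N_0^s$, with bit sets $\kappa_1,\dots,\kappa_s$, let $\lceil k\rceil_q=(\lceil\kappa_1\rceil_q,\dots,\lceil\kappa_s\rceil_q)$ and $$\hat f(k)=\int_{[0,1]^s}f(x)\prod_{j=1}^s\mathrm{wal}_{k_j}(x_j)\,\mathrm dx.$$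 *Claim.* Suppose $\|f\|_{\alpha,\lambda}<\infty$. Let $\ell\in\mathbb N_0^s\setminus\{0\}$, $\|\ell\|_1=\sum_{j}\ell_j$, and $B_{\alpha,\ell,s}=\{k\in\mathbb N_0^s\setminus\{0\}:\lceil k\rceil_{\alpha+1}=\ell\}$. Then $$\Bigl(\sum_{k\in B_{\alpha,\ell,s}}|\hat f(k)|^2\Bigr)^{1/2}\le C_\lambda^s\,\|f\|_{\alpha,\lambda}\,2^{-(\alpha+\lambda)\|\ell\|_1},$$ where $C_\lambda=2\sqrt2/\Gamma(\lambda+1)$ if $0<\lambda<1$ and $C_1=\sqrt2$; in particular the series on the left converges. -/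

import Mathlib

namespace FracWalsh

/-! ### Binary digits and Walsh coefficients -/

/-- For `k = ∑_{l ≥ 1} a_l 2^(l-1)`, the set `κ = {l ≥ 1 | a_l = 1}` of its nonzero bits
(such an `l` satisfies `l ≤ 2^(l-1) ≤ k`). -/
def bitSet (k : ℕ) : Finset ℕ := (Finset.Icc 1 k).filter fun l => k.testBit (l - 1) = true

/-- For `q ≥ 1`, the `q`-th largest element of `κ`, and `0` if `q > |κ|`. -/
def nthLargest (κ : Finset ℕ) (q : ℕ) : ℕ := (κ.sort (· ≥ ·)).getD (q - 1) 0

/-- The `l`-th digit of the binary expansion `x = ∑_{l ≥ 1} x_l 2^(-l)` of `x ∈ [0,1)`, where the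
expansion with finitely many ones is chosen when there are two. -/
noncomputable def binDigit (x : ℝ) (l : ℕ) : ℕ := ⌊2 ^ l * x⌋₊ % 2

/-- The univariate Walsh function with index `k`. -/
noncomputable def wal (k : ℕ) (x : ℝ) : ℝ := (-1) ^ ∑ l ∈ bitSet k, binDigit x l

/-- The Walsh coefficient `∫_{[0,1]^s} f(x) ∏_j wal_{k_j}(x_j) dx`. -/
noncomputable def walshCoeff {s : ℕ} (f : (Fin s → ℝ) → ℝ) (k : Fin s → ℕ) : ℝ :=
  ∫ x in Set.Icc (0 : Fin s → ℝ) 1, f x * ∏ j, wal (k j) (x j)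

/-- The block of nonzero frequencies `k` such that the `(α+1)`-st largest nonzero bit of `k_j`
is `ℓ_j` for each `j`. -/
def block {s : ℕ} (α : ℕ) (ℓ : Fin s → ℕ) : Set (Fin s → ℕ) :=
  {k | k ≠ 0 ∧ ∀ j, nthLargest (bitSet (k j)) (α + 1) = ℓ j}

/-! ### Dominating mixed derivatives on the closed unit cube -/

/-- The partial derivative in the `j`-th variable (one-sided at the boundary of the cube). -/
noncomputable def partialDeriv {s : ℕ} (j : Fin s) (f : (Fin s → ℝ) → ℝ) :
    (Fin s → ℝ) → ℝ :=
  fun x => derivWithin (fun t => f (Function.update x j t)) (Set.Icc 0 1) (x j)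

/-- `f^(a) = ∂^(a_1 + ⋯ + a_s) f / ∂x_1^(a_1) ⋯ ∂x_s^(a_s)`. -/
noncomputable def mixedDeriv {s : ℕ} (f : (Fin s → ℝ) → ℝ) (a : Fin s → ℕ) :
    (Fin s → ℝ) → ℝ :=
  (List.finRange s).foldr (fun j g => (partialDeriv j)^[a j] g) f

/-- On the cube, `f` can be differentiated up to `α` times in each variable: for all `a` with
`a_i ≤ α` and all `j` with `a_j < α`, the partial derivative of `f^(a)` in the variable `x_j`
exists and is `f^(a + e_j)`. -/
def HasMixedDerivs {s : ℕ} (f : (Fin s → ℝ) → ℝ) (α : ℕ) : Prop :=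
  ∀ a : Fin s → ℕ, (∀ i, a i ≤ α) → ∀ j, a j < α → ∀ x ∈ Set.Icc (0 : Fin s → ℝ) 1,
    HasDerivWithinAt (fun t => mixedDeriv f a (Function.update x j t))
      (mixedDeriv f (a + Pi.single j 1) x) (Set.Icc 0 1) (x j)

/-! ### The fractional Sobolev space -/

/-- `y ↦ y_+^(lam-1)`, equal to `0` for `y ≤ 0` (also when `lam = 1`). -/
noncomputable def posPow (lam y : ℝ) : ℝ := if 0 < y then y ^ (lam - 1) else 0

/-- `D = (D_u)_u` is a family of `lam`-fractional derivatives of `g`, with `D_u ∈ L^p([0,1]^u)`: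
for all `x` in the cube,
`g(x) = ∑_u Γ(lam)^(-|u|) ∫_{[0,1]^u} D_u(t) ∏_{j ∈ u} (x_j - t_j)_+^(lam-1) dt`. -/
structure IsFracDeriv {s : ℕ} (lam : ℝ) (p : ENNReal) (g : (Fin s → ℝ) → ℝ)
    (D : (u : Finset (Fin s)) → (u → ℝ) → ℝ) : Prop where
  memLp : ∀ u, MeasureTheory.MemLp (D u) p
    (MeasureTheory.volume.restrict (Set.Icc (0 : u → ℝ) 1))
  repr : ∀ x ∈ Set.Icc (0 : Fin s → ℝ) 1,
    g x = ∑ u : Finset (Fin s), (Real.Gamma lam ^ u.card)⁻¹ *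
      ∫ t in Set.Icc (0 : u → ℝ) 1, D u t * ∏ j : u, posPow lam (x j - t j)

/-- `(∑_u ‖D_u‖²_{L²([0,1]^u)})^(1/2)` for a family `D = (D_u)_u`. -/
noncomputable def familyNorm {s : ℕ} (D : (u : Finset (Fin s)) → (u → ℝ) → ℝ) : ENNReal :=
  (∑ u : Finset (Fin s), MeasureTheory.eLpNorm (D u) 2
    (MeasureTheory.volume.restrict (Set.Icc (0 : u → ℝ) 1)) ^ 2) ^ (1 / 2 : ℝ)

/-- The norm `‖g‖_{lam,s}`: it is `familyNorm D` if `g` has `lam`-fractional derivatives `D` in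
`L^p` for some `p ≥ 2` with `p > 1/lam`, and `∞` otherwise. Fractional derivatives are unique
up to null sets, so the infimum below is over one value at most. -/
noncomputable def fracNorm {s : ℕ} (lam : ℝ) (g : (Fin s → ℝ) → ℝ) : ENNReal :=
  ⨅ (D : (u : Finset (Fin s)) → (u → ℝ) → ℝ)
    (_ : ∃ p : ENNReal, 2 ≤ p ∧ ENNReal.ofReal lam⁻¹ < p ∧ IsFracDeriv lam p g D),
    familyNorm D

open Classical in
/-- The norm `‖f‖_{α,lam} = (∑_{a ∈ {0,…,α}^s} ‖f^(a)‖²_{lam,s})^(1/2)`, and `∞` if one of these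
mixed derivatives does not exist. -/
noncomputable def sobolevNorm {s : ℕ} (α : ℕ) (lam : ℝ) (f : (Fin s → ℝ) → ℝ) : ENNReal :=
  if HasMixedDerivs f α then
    (∑ a ∈ Fintype.piFinset (fun _ : Fin s => Finset.range (α + 1)),
      fracNorm lam (mixedDeriv f a) ^ 2) ^ (1 / 2 : ℝ)
  else ⊤

/-- The constant `C_lam`, for `0 < lam ≤ 1`. -/
noncomputable def constC (lam : ℝ) : ℝ :=
  if lam < 1 then 2 * √2 / Real.Gamma (lam + 1) else √2

end FracWalsh

/-! In one variable, a Walsh function is the product of the Rademacher functions at the bits of `k`.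
Integrating the factor of the highest remaining level `b` gains `2^(-b)`, and the primitive vanishes
at the dyadic points of level `b - 1`, so all lower factors can be pulled out of the integral. Hence
the `α`-fold primitive `walPrim k α` is `T` times the Rademacher functions of the remaining bits,
where `T` depends only on the `α` largest bits `b_i` and `|T| ≤ ∏ 2^(-b_i)`. Primitives of positive
order vanish at 0 and 1, so integration by parts moves derivatives onto `f` without boundary terms.
This is done `α` times in every variable with `ℓ_j ≥ 1`, and not at all where `ℓ_j = 0`.

The extra `lam` orders come from the next bit `l = ℓ_j`. Its Rademacher function changes sign under
translation by `h = 2^(-l)`, while `T` is `h`-periodic. Pairing neighbouring half intervals replaces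
the fractional integral of `D` by its differences at distance `h`, that is, by the convolution of
`D` with a kernel of `L¹`-norm at most `2 h^lam / lam` (exactly `h` if `lam = 1`); Young's
inequality bounds it. For fixed top bits, Bessel's inequality handles all remaining bits at once.
Summing `∏ 4^(-b_i)` over `b_i > l` costs at most `4^(-lα)`. This is `bessel_walPrim`.

In several variables, inserting the fractional representation of the mixed derivative and exchanging
integrals turns the coefficient, up to sign, into a sum over `u` of integrals of `D_u` against
tensor products of one-dimensional functions (`IsFracDeriv.integral_mul_walPrim`). Bessel
inequalities tensorize (`BesselOn.pi`), so each `u` contributes a product of one-dimensional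
constants (`besselOn_fracCoef`) times `‖D_u‖²`. Cauchy–Schwarz over the `2^s` sets `u` accounts for
a factor `√2` per variable in `constC`. -/

namespace FracWalsh

open MeasureTheory Set Filter Topology
open scoped ENNReal

/-! ### Rademacher functions and their products -/

/-- The Rademacher function of level `b` on the real line. -/
noncomputable def rad (b : ℕ) (x : ℝ) : ℝ := if Even ⌊(2 : ℝ) ^ b * x⌋ then 1 else -1

lemma rad_eq_one_or (b : ℕ) (x : ℝ) : rad b x = 1 ∨ rad b x = -1 := by
  unfold rad; split_ifs <;> simp

lemma abs_rad (b : ℕ) (x : ℝ) : |rad b x| = 1 := by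
  rcases rad_eq_one_or b x with h | h <;> simp [h]

lemma rad_mul_self (b : ℕ) (x : ℝ) : rad b x * rad b x = 1 := by
  rcases rad_eq_one_or b x with h | h <;> simp [h]

@[fun_prop]
lemma measurable_rad (b : ℕ) : Measurable (rad b) := by
  unfold rad
  refine Measurable.ite ?_ measurable_const measurable_const
  have : Measurable fun x : ℝ => ⌊(2 : ℝ) ^ b * x⌋ := by fun_prop
  exact this (MeasurableSet.of_discrete (s := {n : ℤ | Even n}))

lemma rad_antiperiodic (b : ℕ) : Function.Antiperiodic (rad b) ((1 / 2) ^ b) := by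
  intro x
  have h : (2 : ℝ) ^ b * (x + (1 / 2) ^ b) = 2 ^ b * x + 1 := by
    rw [mul_add, ← mul_pow]; norm_num
  unfold rad
  rw [h, Int.floor_add_one]
  by_cases h' : Even ⌊(2 : ℝ) ^ b * x⌋ <;> simp [h']

lemma half_pow_eq_two_pow_mul {c b : ℕ} (h : c ≤ b) :
    ((1 : ℝ) / 2) ^ c = ((2 ^ (b - c) : ℕ) : ℝ) * (1 / 2) ^ b := by
  obtain ⟨d, rfl⟩ := Nat.exists_eq_add_of_le h
  rw [Nat.add_sub_cancel_left, pow_add]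
  push_cast
  rw [mul_left_comm, ← mul_pow]; norm_num

lemma Periodic.half_pow {f : ℝ → ℝ} {c b : ℕ} (h : c ≤ b)
    (hf : Function.Periodic f ((1 / 2) ^ b)) : Function.Periodic f ((1 / 2) ^ c) := by
  rw [half_pow_eq_two_pow_mul h]
  exact hf.nat_mul _

lemma two_mul_half_pow_succ (c : ℕ) : 2 * ((1 : ℝ) / 2) ^ (c + 1) = (1 / 2) ^ c := by
  rw [pow_succ]; ring

lemma rad_periodic {c b : ℕ} (h : c < b) : Function.Periodic (rad b) ((1 / 2) ^ c) := by
  obtain ⟨d, rfl⟩ : ∃ d, b = d + 1 := ⟨b - 1, by omega⟩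
  have := (rad_antiperiodic (d + 1)).periodic_two_mul
  rw [two_mul_half_pow_succ] at this
  exact Periodic.half_pow (by omega) this

lemma floor_two_pow_mul {c l : ℕ} (h : c ≤ l) (x : ℝ) :
    ⌊(2 : ℝ) ^ c * x⌋ = ⌊(2 : ℝ) ^ l * x⌋ / 2 ^ (l - c) := by
  obtain ⟨d, rfl⟩ := Nat.exists_eq_add_of_le h
  have := Int.floor_div_natCast ((2 : ℝ) ^ (c + d) * x) (2 ^ d)
  rw [Nat.add_sub_cancel_left]
  push_cast at this
  rw [← this]
  congr 1
  rw [pow_add]; field_simp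

/-- An even floor means that the `l`-th binary digit is 0; adding `2^(-l)` turns it into 1 without a
carry into the coarser digits. -/
lemma rad_add_half_pow {c l : ℕ} (h : c < l) {x : ℝ} (hx : rad l x = 1) :
    rad c (x + (1 / 2) ^ l) = rad c x := by
  have he : Even ⌊(2 : ℝ) ^ l * x⌋ := by
    unfold rad at hx; split_ifs at hx with h'
    · exact h'
    · norm_num at hx
  have h1 : (2 : ℝ) ^ l * (x + (1 / 2) ^ l) = 2 ^ l * x + 1 := by
    rw [mul_add, ← mul_pow]; norm_num
  unfold rad
  rw [floor_two_pow_mul h.le, floor_two_pow_mul h.le x, h1, Int.floor_add_one]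
  obtain ⟨m, hm⟩ := he
  obtain ⟨d, hd⟩ : ∃ d, l - c = d + 1 := ⟨l - c - 1, by omega⟩
  rw [hd, hm, pow_succ', ← Int.ediv_ediv_of_nonneg (by norm_num),
    ← Int.ediv_ediv_of_nonneg (by norm_num)]
  have : (m + m + 1) / 2 = (m + m) / 2 := by omega
  rw [this]

/-- The floor is locally constant to the right. This one-sided continuity gives primitives of Walsh
functions a right derivative at every point, which suffices for integration by parts. -/
lemma rad_continuousWithinAt (b : ℕ) (x : ℝ) : ContinuousWithinAt (rad b) (Ici x) x := by
  have h1 : Tendsto (fun y : ℝ => (2 : ℝ) ^ b * y) (𝓝[≥] x) (𝓝[≥] ((2 : ℝ) ^ b * x)) := by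
    refine tendsto_nhdsWithin_of_tendsto_nhds_of_eventually_within _ ?_ ?_
    · exact (Continuous.tendsto (by fun_prop) x).mono_left nhdsWithin_le_nhds
    · filter_upwards [self_mem_nhdsWithin] with y hy
      exact mul_le_mul_of_nonneg_left (mem_Ici.1 hy) (by positivity : (0 : ℝ) ≤ 2 ^ b)
  have h2 := (tendsto_floor_right_pure_floor ((2 : ℝ) ^ b * x)).comp h1
  have h3 : ∀ᶠ y in 𝓝[≥] x, ⌊(2 : ℝ) ^ b * y⌋ = ⌊(2 : ℝ) ^ b * x⌋ := tendsto_pure.1 h2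
  refine ContinuousWithinAt.congr_of_eventuallyEq (f := fun _ => rad b x)
    continuousWithinAt_const ?_ rfl
  filter_upwards [h3] with y hy
  simp only [rad, hy]

/-- The product of the Rademacher functions whose levels lie in `R`. -/
noncomputable def radProd (R : Finset ℕ) (x : ℝ) : ℝ := ∏ b ∈ R, rad b x

@[fun_prop]
lemma measurable_radProd (R : Finset ℕ) : Measurable (radProd R) := by
  unfold radProd; fun_prop

lemma abs_radProd (R : Finset ℕ) (x : ℝ) : |radProd R x| = 1 := by
  simp [radProd, Finset.abs_prod, abs_rad]

lemma radProd_insert {R : Finset ℕ} {b : ℕ} (h : b ∉ R) (x : ℝ) :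
    radProd (insert b R) x = rad b x * radProd R x := Finset.prod_insert h

lemma radProd_continuousWithinAt (R : Finset ℕ) (x : ℝ) :
    ContinuousWithinAt (radProd R) (Ici x) x := by
  unfold radProd
  exact tendsto_finsetProd _ fun b _ => rad_continuousWithinAt b x

/-- Common factors square to 1. This reduces orthogonality to the vanishing of the integral of a
single product. -/
lemma radProd_mul_radProd (R R' : Finset ℕ) (x : ℝ) :
    radProd R x * radProd R' x = radProd (symmDiff R R') x := by
  have h1 : R = (R \ R') ∪ (R ∩ R') := (Finset.sdiff_union_inter R R').symm
  have h2 : R' = (R' \ R) ∪ (R ∩ R') := by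
    rw [Finset.inter_comm]; exact (Finset.sdiff_union_inter R' R).symm
  have d1 : Disjoint (R \ R') (R ∩ R') := Finset.disjoint_sdiff_inter R R'
  have d2 : Disjoint (R' \ R) (R ∩ R') := by
    rw [Finset.inter_comm]; exact Finset.disjoint_sdiff_inter R' R
  have e1 : radProd R x = radProd (R \ R') x * radProd (R ∩ R') x := by
    conv_lhs => rw [h1]
    exact Finset.prod_union d1
  have e2 : radProd R' x = radProd (R' \ R) x * radProd (R ∩ R') x := by
    conv_lhs => rw [h2]
    exact Finset.prod_union d2
  have e3 : radProd (symmDiff R R') x = radProd (R \ R') x * radProd (R' \ R) x := by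
    rw [symmDiff_def]
    exact Finset.prod_union (disjoint_sdiff_sdiff)
  have e4 : radProd (R ∩ R') x * radProd (R ∩ R') x = 1 := by
    rw [radProd, ← Finset.prod_mul_distrib]
    simp [rad_mul_self]
  rw [e1, e2, e3]
  linear_combination radProd (R \ R') x * radProd (R' \ R) x * e4

lemma wal_eq_radProd (k : ℕ) {x : ℝ} (hx : 0 ≤ x) : wal k x = radProd (bitSet k) x := by
  unfold wal radProd
  rw [← Finset.prod_pow_eq_pow_sum]
  refine Finset.prod_congr rfl fun l _ => ?_
  unfold binDigit rad
  have h0 : 0 ≤ (2 : ℝ) ^ l * x := by positivity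
  rw [← Int.natCast_floor_eq_floor h0]
  simp only [Int.even_coe_nat]
  rcases Nat.even_or_odd ⌊(2 : ℝ) ^ l * x⌋₊ with h | h
  · simp [h, Nat.even_iff.1 h]
  · simp [Nat.not_even_iff_odd.2 h, Nat.odd_iff.1 h]

/-! ### Primitives -/

lemma intervalIntegrable_of_abs_le {g : ℝ → ℝ} (hg : Measurable g) {C : ℝ}
    (hC : ∀ x, |g x| ≤ C) (a b : ℝ) : IntervalIntegrable g volume a b := by
  refine (intervalIntegrable_const (c := C)).mono_fun hg.aestronglyMeasurable ?_
  filter_upwards with x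
  simpa using (hC x).trans (le_abs_self C)

lemma integral_antiperiodic_eq_zero {g : ℝ → ℝ} {p : ℝ} (hp : Function.Antiperiodic g p)
    (hg : ∀ a b, IntervalIntegrable g volume a b) (x : ℝ) :
    ∫ y in x..(x + 2 * p), g y = 0 := by
  rw [← intervalIntegral.integral_add_adjacent_intervals (hg x (x + p)) (hg _ _)]
  have h : ∫ y in (x + p)..(x + 2 * p), g y = ∫ y in x..(x + p), g (y + p) := by
    rw [intervalIntegral.integral_comp_add_right]; ring_nf
  rw [h]
  simp [hp _]

lemma primitive_periodic {g : ℝ → ℝ} {p : ℝ} (hp : Function.Antiperiodic g p)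
    (hg : ∀ a b, IntervalIntegrable g volume a b) :
    Function.Periodic (fun x => ∫ y in (0 : ℝ)..x, g y) (2 * p) := by
  intro x
  simp only
  rw [← intervalIntegral.integral_add_adjacent_intervals (hg 0 x) (hg _ _),
    integral_antiperiodic_eq_zero hp hg, add_zero]

/-- The gain `p` of one integration. By periodicity the point may be taken in `[0, 2p)`; in the
first half of the period the bound is direct, and in the second the mean zero over a period allows
integrating from the point up to `2p` instead. -/
lemma abs_primitive_le {g : ℝ → ℝ} {p C : ℝ} (hp0 : 0 < p) (hp : Function.Antiperiodic g p)
    (hg : ∀ a b, IntervalIntegrable g volume a b) (hC : ∀ x, |g x| ≤ C) (x : ℝ) :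
    |∫ y in (0 : ℝ)..x, g y| ≤ p * C := by
  obtain ⟨y, hy, hxy⟩ := (primitive_periodic hp hg).exists_mem_Ico₀ (by positivity : 0 < 2 * p) x
  rw [hxy]
  have hC0 : 0 ≤ C := (abs_nonneg _).trans (hC 0)
  have key : ∀ a b : ℝ, |∫ y in a..b, g y| ≤ C * |b - a| := fun a b => by
    simpa using intervalIntegral.norm_integral_le_of_norm_le_const (f := g) (a := a) (b := b)
      (C := C) (fun x _ => by simpa using hC x)
  rcases le_total y p with h | h
  · refine (key 0 y).trans ?_
    rw [sub_zero, abs_of_nonneg hy.1, mul_comm]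
    gcongr
  · have h0 : ∫ y in (0 : ℝ)..(2 * p), g y = 0 := by
      simpa using integral_antiperiodic_eq_zero hp hg 0
    have h1 := intervalIntegral.integral_add_adjacent_intervals (hg 0 y) (hg y (2 * p))
    have h2 : ∫ z in (0 : ℝ)..y, g z = -∫ z in y..(2 * p), g z := by linarith
    rw [h2, abs_neg]
    refine (key y (2 * p)).trans ?_
    rw [abs_of_nonneg (by linarith [hy.2]), mul_comm]
    gcongr
    linarith

lemma integral_zero_one_eq_zero {g : ℝ → ℝ} {c : ℕ} (hc : 1 ≤ c)
    (hp : Function.Antiperiodic g ((1 / 2) ^ c))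
    (hg : ∀ a b, IntervalIntegrable g volume a b) : ∫ y in (0 : ℝ)..1, g y = 0 := by
  obtain ⟨d, rfl⟩ : ∃ d, c = d + 1 := ⟨c - 1, by omega⟩
  have h := primitive_periodic hp hg
  rw [two_mul_half_pow_succ] at h
  have h1 := Periodic.half_pow (Nat.zero_le d) h
  have h2 := h1 0
  simpa using h2

/-! ### Orthogonality, and pulling coarse factors out of primitives -/

lemma radProd_antiperiodic {R : Finset ℕ} {c : ℕ} (hc : c ∈ R) (hR : ∀ b ∈ R, c ≤ b) :
    Function.Antiperiodic (radProd R) ((1 / 2) ^ c) := by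
  intro x
  rw [← Finset.insert_erase hc, radProd_insert (Finset.notMem_erase _ _),
    radProd_insert (Finset.notMem_erase _ _), rad_antiperiodic c x, neg_mul]
  congr 2
  refine Finset.prod_congr rfl fun b hb => ?_
  have h1 := hR b (Finset.mem_of_mem_erase hb)
  exact rad_periodic (lt_of_le_of_ne h1 (Finset.ne_of_mem_erase hb).symm) x

/-- The coarsest level `c` in `R` makes the whole integrand antiperiodic under `2^(-c)`, and `[0,1]`
consists of full periods `2 * 2^(-c)` because `c ≥ 1`. -/
lemma integral_mul_radProd_eq_zero {g : ℝ → ℝ} (hg : Measurable g) {C : ℝ}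
    (hC : ∀ x, |g x| ≤ C) {R : Finset ℕ} (hR : R.Nonempty) (hR1 : ∀ b ∈ R, 1 ≤ b)
    (hp : ∀ b ∈ R, Function.Periodic g ((1 / 2) ^ b)) :
    ∫ y in (0 : ℝ)..1, g y * radProd R y = 0 := by
  have hm := R.min'_mem hR
  refine integral_zero_one_eq_zero (c := R.min' hR) (hR1 _ hm) ?_ ?_
  · intro x
    simp only
    rw [hp _ hm x, radProd_antiperiodic hm (fun b hb => R.min'_le b hb) x, mul_neg]
  · refine intervalIntegrable_of_abs_le (by fun_prop) (C := C) fun x => ?_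
    rw [abs_mul, abs_radProd, mul_one]
    exact hC x

lemma integral_radProd_mul_radProd {R R' : Finset ℕ} (hR : ∀ b ∈ R, 1 ≤ b)
    (hR' : ∀ b ∈ R', 1 ≤ b) :
    ∫ y in (0 : ℝ)..1, radProd R y * radProd R' y = if R = R' then 1 else 0 := by
  simp_rw [radProd_mul_radProd]
  split_ifs with h
  · subst h
    simp [radProd]
  · have h1 : (symmDiff R R').Nonempty := by
      rw [Finset.nonempty_iff_ne_empty]
      intro h2
      exact h (symmDiff_eq_bot.1 h2)
    have h2 : ∀ b ∈ symmDiff R R', 1 ≤ b := by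
      intro b hb
      rcases Finset.mem_symmDiff.1 hb with h | h
      · exact hR b h.1
      · exact hR' b h.1
    simpa using integral_mul_radProd_eq_zero (g := fun _ => 1) measurable_const (C := 1)
      (by simp) h1 h2 (fun _ _ _ => rfl)

lemma rad_eq_neg_one_pow {b M : ℕ} {x : ℝ} (h1 : (M : ℝ) * (1 / 2) ^ b ≤ x)
    (h2 : x < ((M : ℝ) + 1) * (1 / 2) ^ b) : rad b x = (-1) ^ M := by
  have hb : (2 : ℝ) ^ b * (1 / 2) ^ b = 1 := by rw [← mul_pow]; norm_num
  have hp : (0 : ℝ) < 2 ^ b := by positivity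
  have : ⌊(2 : ℝ) ^ b * x⌋ = (M : ℤ) := by
    rw [Int.floor_eq_iff]
    constructor
    · push_cast
      nlinarith
    · push_cast
      nlinarith
  unfold rad
  rw [this]
  rcases Nat.even_or_odd M with h | h
  · simp [h]
  · simp [h, Nat.not_even_iff_odd.2 h]

/-- If a primitive vanishes at the dyadic points of level `b`, multiplying by `rad b` commutes
with taking the primitive. -/
lemma primitive_mul_rad {g : ℝ → ℝ} (hg : ∀ a b, IntervalIntegrable g volume a b)
    {b : ℕ} (hb : ∀ M : ℕ, ∫ y in (0 : ℝ)..(M * (1 / 2) ^ b), g y = 0)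
    (hgr : ∀ a c, IntervalIntegrable (fun y => g y * rad b y) volume a c)
    {x : ℝ} (hx : 0 ≤ x) :
    ∫ y in (0 : ℝ)..x, g y * rad b y = (∫ y in (0 : ℝ)..x, g y) * rad b x := by
  set h : ℝ := (1 / 2) ^ b with hh
  have hpos : 0 < h := by positivity
  have cell : ∀ M : ℕ, ∀ x, M * h ≤ x → x ≤ (M + 1) * h →
      ∫ y in (M * h)..x, g y * rad b y = (∫ y in (0 : ℝ)..x, g y) * (-1) ^ M := by
    intro M x h1 h2
    have e1 : ∫ y in (M * h)..x, g y * rad b y = ∫ y in (M * h)..x, g y * (-1) ^ M := by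
      apply intervalIntegral.integral_congr_ae
      -- The right end point may already belong to the next cell, where the sign has flipped.
      have : ∀ᵐ y : ℝ ∂volume, y ≠ x := by
        simp [ae_iff]
      filter_upwards [this] with y hy hy2
      rw [uIoc_of_le h1] at hy2
      rw [rad_eq_neg_one_pow (M := M) hy2.1.le
        ((lt_of_le_of_ne hy2.2 hy).trans_le h2)]
    rw [e1, intervalIntegral.integral_mul_const,
      ← intervalIntegral.integral_add_adjacent_intervals (hg 0 (M * h)) (hg _ x), hb M, zero_add]
  have start : ∀ M : ℕ, ∫ y in (0 : ℝ)..(M * h), g y * rad b y = 0 := by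
    intro M
    induction M with
    | zero => simp
    | succ M ih =>
      rw [← intervalIntegral.integral_add_adjacent_intervals (hgr 0 (M * h)) (hgr _ _), ih,
        cell M _ (by push_cast; nlinarith) (by push_cast; rfl), hb, zero_mul, add_zero]
  set M := ⌊x / h⌋₊
  have h1 : (M : ℝ) * h ≤ x := by
    rw [← le_div_iff₀ hpos]; exact Nat.floor_le (by positivity)
  have h2 : x < ((M : ℝ) + 1) * h := by
    rw [← div_lt_iff₀ hpos]; exact Nat.lt_floor_add_one _
  rw [← intervalIntegral.integral_add_adjacent_intervals (hgr 0 (M * h)) (hgr _ _), start,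
    cell M x h1 h2.le, zero_add, rad_eq_neg_one_pow h1 h2]

/-- Levels are inserted one at a time. The primitive of `g` vanishes at 0 and has period `2^(-c)`,
hence vanishes at the dyadic points of every level `b ≤ c`, and it keeps doing so after
multiplication by the earlier factors; `primitive_mul_rad` then applies. -/
lemma primitive_mul_radProd {g : ℝ → ℝ} (hg : Measurable g) {C : ℝ} (hC : ∀ x, |g x| ≤ C)
    {c : ℕ} (hc : Function.Periodic (fun x => ∫ y in (0 : ℝ)..x, g y) ((1 / 2) ^ c))
    {R : Finset ℕ} (hR : ∀ b ∈ R, b ≤ c) {x : ℝ} (hx : 0 ≤ x) :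
    ∫ y in (0 : ℝ)..x, g y * radProd R y = (∫ y in (0 : ℝ)..x, g y) * radProd R x := by
  induction R using Finset.induction_on generalizing x with
  | empty => simp [radProd]
  | insert b R hb ih =>
    have hb' : ∀ b ∈ R, b ≤ c := fun b' h' => hR b' (Finset.mem_insert_of_mem h')
    simp_rw [radProd_insert hb, mul_comm (rad b _), ← mul_assoc]
    have hi : ∀ R : Finset ℕ, ∀ a b, IntervalIntegrable (fun y => g y * radProd R y) volume a b :=
      fun R => intervalIntegrable_of_abs_le (by fun_prop) (C := C) fun x => by
        rw [abs_mul, abs_radProd, mul_one]; exact hC x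
    rw [primitive_mul_rad (hi R) ?_ ?_ hx, ih hb' hx]
    · intro M
      rw [ih hb' (by positivity)]
      have h1 := (Periodic.half_pow (hR b (Finset.mem_insert_self _ _)) hc).nat_mul M 0
      simp only [zero_add, intervalIntegral.integral_same] at h1
      rw [h1, zero_mul]
    · exact intervalIntegrable_of_abs_le (by fun_prop) (C := C) fun x => by
        rw [abs_mul, abs_mul, abs_radProd, abs_rad, mul_one, mul_one]; exact hC x

/-! ### Periodicity and size of iterated primitives -/

/-- Iterated primitives of Rademacher functions of levels `b 0, b 1, …`. -/
noncomputable def iterPrim (b : ℕ → ℕ) : ℕ → ℝ → ℝ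
  | 0, _ => 1
  | n + 1, x => ∫ y in (0 : ℝ)..x, iterPrim b n y * rad (b n) y

lemma iterPrim_congr {b b' : ℕ → ℕ} {n : ℕ} (h : ∀ i < n, b i = b' i) :
    iterPrim b n = iterPrim b' n := by
  induction n with
  | zero => rfl
  | succ n ih =>
    ext x
    simp only [iterPrim]
    rw [ih fun i hi => h i (by omega), h n (by omega)]

/-- Periodicity and size are proved together: the period `2^(-b n)` of the previous primitive makes
the next integrand antiperiodic, which yields both the factor `2^(-b n)` and the new period `2 *
2^(-b n)`. The doubled period is why `c < b i` must be strict. -/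
lemma iterPrim_measurable_bounded (b : ℕ → ℕ) (n : ℕ) (h : ∀ i j, i < j → j < n → b j < b i) :
    Measurable (iterPrim b n) ∧
      (∀ c, (∀ i < n, c < b i) → Function.Periodic (iterPrim b n) ((1 / 2) ^ c)) ∧
      ∀ x, |iterPrim b n x| ≤ ∏ i ∈ Finset.range n, (1 / 2 : ℝ) ^ b i := by
  induction n with
  | zero =>
    refine ⟨measurable_const, fun c _ x => rfl, fun x => by simp [iterPrim]⟩
  | succ n ih =>
    obtain ⟨h1, h2, h3⟩ := ih fun i j hi hj => h i j hi (by omega)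
    have hanti : Function.Antiperiodic (fun y => iterPrim b n y * rad (b n) y)
        ((1 / 2) ^ b n) := by
      intro x
      simp only
      rw [h2 (b n) (fun i hi => h i n hi (by omega)) x, rad_antiperiodic, mul_neg]
    have hbd : ∀ x, |iterPrim b n x * rad (b n) x| ≤
        ∏ i ∈ Finset.range n, (1 / 2 : ℝ) ^ b i := fun x => by
      rw [abs_mul, abs_rad, mul_one]; exact h3 x
    have hint := intervalIntegrable_of_abs_le (by fun_prop) hbd
    refine ⟨?_, ?_, ?_⟩
    · have : Continuous (iterPrim b (n + 1)) := intervalIntegral.continuous_primitive hint 0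
      exact this.measurable
    · intro c hc
      have hcn := hc n (by omega)
      obtain ⟨d, hd⟩ : ∃ d, b n = d + 1 := ⟨b n - 1, by omega⟩
      have := primitive_periodic hanti hint
      rw [hd, two_mul_half_pow_succ] at this
      have h4 := Periodic.half_pow (by omega : c ≤ d) this
      rw [← hd] at h4
      exact h4
    · intro x
      rw [Finset.prod_range_succ, mul_comm]
      exact abs_primitive_le (by positivity) hanti hint hbd x

lemma iterPrim_continuous (b : ℕ → ℕ) (n : ℕ) (h : ∀ i j, i < j → j < n → b j < b i) :
    Continuous (iterPrim b n) := by
  cases n with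
  | zero => exact continuous_const
  | succ n =>
    obtain ⟨h1, h2, h3⟩ := iterPrim_measurable_bounded b n fun i j hi hj => h i j hi (by omega)
    refine intervalIntegral.continuous_primitive (fun a c => ?_) 0
    exact intervalIntegrable_of_abs_le (by fun_prop) (fun x => by
      rw [abs_mul, abs_rad, mul_one]; exact h3 x) a c

/-- The primitive of `iterPrim b n * rad (b n) * radProd R` when all levels in `R` are below
`b n`. -/
lemma primitive_iterPrim_mul_radProd (b : ℕ → ℕ) (n : ℕ)
    (h : ∀ i j, i < j → j < n + 1 → b j < b i) {R : Finset ℕ} (hR : ∀ c ∈ R, c < b n) {x : ℝ}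
    (hx : 0 ≤ x) :
    ∫ y in (0 : ℝ)..x, iterPrim b n y * radProd (insert (b n) R) y =
      iterPrim b (n + 1) x * radProd R x := by
  have hn : b n ∉ R := fun h' => lt_irrefl _ (hR _ h')
  obtain ⟨h1, h2, h3⟩ := iterPrim_measurable_bounded b n fun i j hi hj => h i j hi (by omega)
  simp_rw [radProd_insert hn, ← mul_assoc]
  -- For level 0 the subtraction in `b n - 1` below would truncate, but then no level is left for
  -- `R`.
  by_cases hb0 : b n = 0
  · have hRe : R = ∅ := by
      refine Finset.eq_empty_of_forall_notMem fun c hc => ?_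
      have := hR c hc; omega
    subst hRe
    simp [radProd, iterPrim]
  refine primitive_mul_radProd (C := ∏ i ∈ Finset.range n, (1 / 2 : ℝ) ^ b i) (by fun_prop)
    (fun x => ?_) (c := b n - 1) ?_ ?_ hx
  · rw [abs_mul, abs_rad, mul_one]; exact h3 x
  · refine (iterPrim_measurable_bounded b (n + 1) h).2.1 _ fun i hi => ?_
    rcases Nat.lt_succ_iff_lt_or_eq.1 hi with h' | h'
    · have := h i n h' (by omega); omega
    · subst h'; omega
  · intro c hc
    have := hR c hc; omega

/-! ### Iterated primitives of Walsh functions -/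

/-- The bits of `k` in decreasing order, starting from index `0`. -/
noncomputable def topBit (k i : ℕ) : ℕ := nthLargest (bitSet k) (i + 1)

/-- The bits of `k` without the `n` largest ones. -/
noncomputable def remBits (k n : ℕ) : Finset ℕ :=
  (((bitSet k).sort (· ≥ ·)).drop n).toFinset

/-- The `n`-fold primitive of the Walsh function with index `k`. -/
noncomputable def walPrim (k n : ℕ) (x : ℝ) : ℝ :=
  iterPrim (topBit k) n x * radProd (remBits k n) x

lemma one_le_of_mem_bitSet {k l : ℕ} (h : l ∈ bitSet k) : 1 ≤ l :=
  (Finset.mem_Icc.1 (Finset.mem_filter.1 h).1).1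

lemma topBit_eq {k i : ℕ} (h : i < ((bitSet k).sort (· ≥ ·)).length) :
    topBit k i = ((bitSet k).sort (· ≥ ·))[i] := by
  simp only [topBit, nthLargest, Nat.add_sub_cancel]
  exact List.getD_eq_getElem _ _ h

lemma lt_length_of_topBit_ne_zero {k i : ℕ} (h : topBit k i ≠ 0) :
    i < ((bitSet k).sort (· ≥ ·)).length := by
  by_contra h'
  apply h
  simp only [topBit, nthLargest, Nat.add_sub_cancel]
  exact List.getD_eq_default _ _ (by omega)

lemma topBit_lt {k i j : ℕ} (hij : i < j) (h : topBit k j ≠ 0) : topBit k j < topBit k i := by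
  have hj := lt_length_of_topBit_ne_zero h
  rw [topBit_eq hj, topBit_eq (hij.trans hj)]
  exact List.pairwise_iff_getElem.1 (Finset.sortedGT_sort (bitSet k)).pairwise i j _ _ hij

lemma topBit_ne_zero_of_le {k i j : ℕ} (hij : i ≤ j) (h : topBit k j ≠ 0) : topBit k i ≠ 0 := by
  rcases hij.eq_or_lt with rfl | hij
  · exact h
  · have := topBit_lt hij h; omega

lemma remBits_zero (k : ℕ) : remBits k 0 = bitSet k := by simp [remBits]

lemma remBits_subset (k n : ℕ) : remBits k n ⊆ bitSet k := by
  intro c hc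
  have := List.mem_of_mem_drop (List.mem_toFinset.1 hc)
  exact (Finset.mem_sort _).1 this

lemma remBits_eq_insert {k n : ℕ} (h : topBit k n ≠ 0) :
    remBits k n = insert (topBit k n) (remBits k (n + 1)) := by
  have h' := lt_length_of_topBit_ne_zero h
  rw [topBit_eq h', remBits, List.drop_eq_getElem_cons h', List.toFinset_cons]
  rfl

lemma lt_topBit_of_mem_remBits {k n c : ℕ} (h : topBit k n ≠ 0) (hc : c ∈ remBits k (n + 1)) :
    c < topBit k n := by
  have h' := lt_length_of_topBit_ne_zero h
  rw [topBit_eq h']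
  have h1 := List.mem_toFinset.1 hc
  have h2 := ((Finset.sortedGT_sort (bitSet k)).pairwise).sublist
    (List.drop_sublist n ((bitSet k).sort (· ≥ ·)))
  rw [List.drop_eq_getElem_cons h'] at h2
  exact (List.pairwise_cons.1 h2).1 c h1

lemma topBit_strictAnti {k n : ℕ} (h : ∀ i < n, topBit k i ≠ 0) :
    ∀ i j, i < j → j < n → topBit k j < topBit k i :=
  fun _ j hij hj => topBit_lt hij (h j hj)

lemma measurable_walPrim {k n : ℕ} (h : ∀ i < n, topBit k i ≠ 0) : Measurable (walPrim k n) := by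
  have := (iterPrim_measurable_bounded _ n (topBit_strictAnti h)).1
  unfold walPrim
  fun_prop

lemma abs_walPrim_le {k n : ℕ} (h : ∀ i < n, topBit k i ≠ 0) (x : ℝ) : |walPrim k n x| ≤ 1 := by
  have h1 := (iterPrim_measurable_bounded _ n (topBit_strictAnti h)).2.2 x
  rw [walPrim, abs_mul, abs_radProd, mul_one]
  refine h1.trans (Finset.prod_le_one (fun _ _ => by positivity) fun i _ => ?_)
  exact pow_le_one₀ (by norm_num) (by norm_num)

lemma walPrim_zero {k : ℕ} {x : ℝ} (hx : 0 ≤ x) : walPrim k 0 x = wal k x := by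
  rw [wal_eq_radProd k hx, walPrim, remBits_zero]; simp [iterPrim]

lemma walPrim_continuousWithinAt {k n : ℕ} (h : ∀ i < n, topBit k i ≠ 0) (x : ℝ) :
    ContinuousWithinAt (walPrim k n) (Ici x) x :=
  (iterPrim_continuous _ n (topBit_strictAnti h)).continuousWithinAt.mul
    (radProd_continuousWithinAt _ x)

/-- Integration moves the largest remaining bit from the Rademacher product into the iterated
primitive; the lower bits stay outside. -/
lemma primitive_walPrim {k n : ℕ} (h : topBit k n ≠ 0) {x : ℝ} (hx : 0 ≤ x) :
    ∫ y in (0 : ℝ)..x, walPrim k n y = walPrim k (n + 1) x := by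
  have := primitive_iterPrim_mul_radProd (topBit k) n
    (topBit_strictAnti fun i hi => topBit_ne_zero_of_le (by omega : i ≤ n) h)
    (fun c hc => lt_topBit_of_mem_remBits h hc) hx
  rw [← remBits_eq_insert h] at this
  exact this

lemma walPrim_succ_zero (k n : ℕ) : walPrim k (n + 1) 0 = 0 := by
  simp [walPrim, iterPrim]

/-- All bits involved are at least 1, so the iterated primitive has period 1 and takes at 1 its
value 0 from the origin. -/
lemma walPrim_succ_one {k n : ℕ} (h : topBit k n ≠ 0) : walPrim k (n + 1) 1 = 0 := by
  have h0 : ∀ i < n + 1, topBit k i ≠ 0 := fun i hi => topBit_ne_zero_of_le (by omega : i ≤ n) h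
  have h1 := (iterPrim_measurable_bounded _ (n + 1) (topBit_strictAnti h0)).2.1 0
    (fun i hi => Nat.pos_of_ne_zero (h0 i hi)) 0
  rw [zero_add, pow_zero] at h1
  rw [walPrim, h1]
  simp [iterPrim]

/-- `walPrim k n` may jump at dyadic points, so the version of integration by parts with right
derivatives is used; both boundary terms vanish. -/
lemma integral_mul_walPrim_eq {k n : ℕ} (h : topBit k n ≠ 0) {F F' : ℝ → ℝ}
    (hF : ∀ x ∈ Icc (0 : ℝ) 1, HasDerivWithinAt F (F' x) (Icc 0 1) x)
    (hF' : IntervalIntegrable F' volume 0 1) :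
    ∫ x in (0 : ℝ)..1, F x * walPrim k n x = -∫ x in (0 : ℝ)..1, F' x * walPrim k (n + 1) x := by
  have h0 : ∀ i < n, topBit k i ≠ 0 := fun i hi => topBit_ne_zero_of_le (by omega : i ≤ n) h
  have hw := intervalIntegrable_of_abs_le (measurable_walPrim h0) (abs_walPrim_le h0)
  have hcont : Continuous fun x => ∫ y in (0 : ℝ)..x, walPrim k n y :=
    intervalIntegral.continuous_primitive hw 0
  have key := intervalIntegral.integral_mul_deriv_eq_deriv_mul_of_hasDeriv_right
    (a := 0) (b := 1) (u := F) (u' := F') (v := fun x => ∫ y in (0 : ℝ)..x, walPrim k n y)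
    (v' := walPrim k n) ?_ hcont.continuousOn ?_ ?_ hF' (hw 0 1)
  · rw [key, primitive_walPrim h zero_le_one, primitive_walPrim h le_rfl, walPrim_succ_zero,
      walPrim_succ_one h]
    simp only [mul_zero, sub_zero, zero_sub]
    congr 1
    refine intervalIntegral.integral_congr fun x hx => ?_
    rw [uIcc_of_le zero_le_one] at hx
    exact congrArg (F' x * ·) (primitive_walPrim h hx.1)
  · rw [uIcc_of_le zero_le_one]
    exact fun x hx => (hF x hx).continuousWithinAt
  · rw [min_eq_left zero_le_one, max_eq_right zero_le_one]
    intro x hx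
    exact ((hF x (Ioo_subset_Icc_self hx)).hasDerivAt (Icc_mem_nhds hx.1 hx.2)).hasDerivWithinAt
  · intro x _
    exact intervalIntegral.integral_hasDerivWithinAt_right (hw 0 x) (s := Ici x) (t := Ioi x)
      ((measurable_walPrim h0).stronglyMeasurable.stronglyMeasurableAtFilter)
      ((walPrim_continuousWithinAt h0 x).mono Ioi_subset_Ici_self) |>.mono Ioi_subset_Ici_self

/-! ### The uniform measure on the unit interval and on the cube -/

/-- The uniform measure on `[0,1]`. -/
noncomputable def unitMeas : Measure ℝ := volume.restrict (Icc 0 1)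

instance : IsProbabilityMeasure unitMeas := ⟨by simp [unitMeas]⟩

lemma cube_eq_pi (ι : Type*) [Fintype ι] :
    volume.restrict (Icc (0 : ι → ℝ) 1) = Measure.pi fun _ => unitMeas := by
  rw [← Set.pi_univ_Icc, volume_pi, Measure.restrict_pi_pi]
  rfl

lemma integral_unitMeas (g : ℝ → ℝ) : ∫ x, g x ∂unitMeas = ∫ x in (0 : ℝ)..1, g x := by
  rw [intervalIntegral.integral_of_le zero_le_one, unitMeas, integral_Icc_eq_integral_Ioc]

lemma ae_unitMeas_mem : ∀ᵐ x ∂unitMeas, x ∈ Icc (0 : ℝ) 1 := ae_restrict_mem measurableSet_Icc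

lemma ae_cube_mem (ι : Type*) [Fintype ι] :
    ∀ᵐ x ∂(Measure.pi fun _ : ι => unitMeas), x ∈ Icc (0 : ι → ℝ) 1 := by
  rw [← cube_eq_pi]; exact ae_restrict_mem measurableSet_Icc

/-- Replacing one coordinate by an independent uniform one does not change the law. Integration in a
single variable thus needs no splitting of the index set. -/
lemma measurePreserving_update {s : ℕ} (j : Fin s) :
    MeasurePreserving (fun z : (Fin s → ℝ) × ℝ => Function.update z.1 j z.2)
      ((Measure.pi fun _ => unitMeas).prod unitMeas) (Measure.pi fun _ => unitMeas) := by
  have hm : Measurable fun z : (Fin s → ℝ) × ℝ => Function.update z.1 j z.2 := by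
    rw [measurable_pi_iff]
    intro i
    by_cases h : i = j
    · subst h; simpa using measurable_snd
    · simp only [Function.update_of_ne h]; fun_prop
  refine ⟨hm, ?_⟩
  symm
  refine Measure.pi_eq fun S hS => ?_
  rw [Measure.map_apply hm (MeasurableSet.univ_pi hS)]
  have : (fun z : (Fin s → ℝ) × ℝ => Function.update z.1 j z.2) ⁻¹' (Set.univ.pi S) =
      (Set.univ.pi (Function.update S j Set.univ)) ×ˢ S j := by
    ext z
    simp only [mem_preimage, Set.mem_pi, mem_univ, true_imp_iff, mem_prod]
    constructor
    · intro h
      refine ⟨fun i => ?_, by simpa using h j⟩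
      by_cases hi : i = j
      · subst hi; simp
      · simpa [Function.update_of_ne hi] using h i
    · rintro ⟨h1, h2⟩ i
      by_cases hi : i = j
      · subst hi; simpa using h2
      · simpa [Function.update_of_ne hi] using h1 i
  rw [this, Measure.prod_prod, Measure.pi_pi,
    ← Finset.prod_erase_mul Finset.univ _ (Finset.mem_univ j),
    ← Finset.prod_erase_mul Finset.univ (fun i => unitMeas (S i)) (Finset.mem_univ j)]
  simp only [Function.update_self, measure_univ, mul_one]
  congr 1
  refine Finset.prod_congr rfl fun i hi => ?_
  rw [Function.update_of_ne (Finset.ne_of_mem_erase hi)]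

/-- This allows every `D_u` to be regarded as a function on the full cube, with unchanged norms, so
that all `u` are treated alike. -/
lemma measurePreserving_restrict_cube {s : ℕ} (u : Finset (Fin s)) :
    MeasurePreserving (fun (x : Fin s → ℝ) (i : u) => x i)
      (Measure.pi fun _ => unitMeas) (Measure.pi fun _ => unitMeas) := by
  have hm : Measurable fun (x : Fin s → ℝ) (i : u) => x i := by fun_prop
  refine ⟨hm, ?_⟩
  symm
  refine Measure.pi_eq fun S hS => ?_
  rw [Measure.map_apply hm (MeasurableSet.univ_pi hS)]
  have : (fun (x : Fin s → ℝ) (i : u) => x i) ⁻¹' (Set.univ.pi S) =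
      Set.univ.pi fun i => if h : i ∈ u then S ⟨i, h⟩ else Set.univ := by
    ext x
    simp only [mem_preimage, Set.mem_pi, mem_univ, true_imp_iff]
    constructor
    · intro h i
      split_ifs with hi
      · exact h ⟨i, hi⟩
      · trivial
    · intro h i
      simpa using h i
  rw [this, Measure.pi_pi, ← Finset.prod_subset (Finset.subset_univ u), ← Finset.prod_coe_sort u]
  · refine Finset.prod_congr rfl fun i _ => ?_
    simp
  · intro i _ hi
    simp [hi]

lemma integral_update {s : ℕ} (j : Fin s) {G : (Fin s → ℝ) → ℝ}
    (hG : Integrable G (Measure.pi fun _ => unitMeas)) :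
    ∫ x, G x ∂(Measure.pi fun _ => unitMeas) =
      ∫ x, ∫ t, G (Function.update x j t) ∂unitMeas ∂(Measure.pi fun _ => unitMeas) := by
  have h := measurePreserving_update j
  rw [← h.map_eq, integral_map h.measurable.aemeasurable (by rw [h.map_eq]; exact hG.1),
    h.map_eq, integral_prod]
  exact h.integrable_comp_of_integrable hG

/-! ### Multivariate integration by parts -/

lemma prod_update_eq {s : ℕ} (w : Fin s → ℝ → ℝ) (j : Fin s) (x : Fin s → ℝ) (t : ℝ) :
    ∏ i, w i (Function.update x j t i) =
      w j t * ∏ i ∈ Finset.univ.erase j, w i (x i) := by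
  rw [← Finset.mul_prod_erase Finset.univ _ (Finset.mem_univ j), Function.update_self]
  congr 1
  refine Finset.prod_congr rfl fun i hi => ?_
  rw [Function.update_of_ne (Finset.ne_of_mem_erase hi)]

lemma abs_prod_le_one {ι : Type*} (S : Finset ι) {g : ι → ℝ} (h : ∀ i, |g i| ≤ 1) :
    |∏ i ∈ S, g i| ≤ 1 := by
  rw [Finset.abs_prod]
  exact Finset.prod_le_one (fun _ _ => abs_nonneg _) fun i _ => h i

/-- `g` coincides on the cube with a bounded measurable function. -/
def BddMeasOnCube {s : ℕ} (g : (Fin s → ℝ) → ℝ) : Prop :=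
  ∃ G : (Fin s → ℝ) → ℝ, Measurable G ∧ (∃ C, ∀ x, |G x| ≤ C) ∧
    EqOn g G (Icc 0 1)

lemma update_mem_cube {s : ℕ} {x : Fin s → ℝ} (hx : x ∈ Icc (0 : Fin s → ℝ) 1) (j : Fin s)
    {t : ℝ} (ht : t ∈ Icc (0 : ℝ) 1) : Function.update x j t ∈ Icc (0 : Fin s → ℝ) 1 := by
  constructor <;> intro i <;> by_cases h : i = j
  · subst h; simpa using ht.1
  · simpa [Function.update_of_ne h] using hx.1 i
  · subst h; simpa using ht.2
  · simpa [Function.update_of_ne h] using hx.2 i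

lemma BddMeasOnCube.integrable_mul {s : ℕ} {g : (Fin s → ℝ) → ℝ} (hg : BddMeasOnCube g)
    {w : Fin s → ℝ → ℝ} (hw : ∀ i, Measurable (w i)) (hw1 : ∀ i x, |w i x| ≤ 1) :
    Integrable (fun x => g x * ∏ i, w i (x i)) (Measure.pi fun _ => unitMeas) := by
  obtain ⟨G, hG, ⟨C, hC⟩, hgG⟩ := hg
  have : Integrable (fun x => G x * ∏ i, w i (x i)) (Measure.pi fun _ => unitMeas) := by
    refine Integrable.of_bound (C := C) (Measurable.aestronglyMeasurable (by fun_prop)) ?_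
    filter_upwards with x
    rw [Real.norm_eq_abs, abs_mul]
    have h1 := abs_prod_le_one Finset.univ fun i => hw1 i (x i)
    have h2 := hC x
    nlinarith [abs_nonneg (G x), abs_nonneg (∏ i, w i (x i))]
  refine this.congr ?_
  filter_upwards [ae_cube_mem (Fin s)] with x hx
  rw [hgG hx]

/-- The other factors are constant along lines in direction `j`, so Fubini reduces this to the
one-dimensional formula on almost every line. -/
lemma integral_cube_ibp {s : ℕ} {j : Fin s} {g g' : (Fin s → ℝ) → ℝ}
    (hg : BddMeasOnCube g) (hg' : BddMeasOnCube g')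
    (hd : ∀ x ∈ Icc (0 : Fin s → ℝ) 1,
      HasDerivWithinAt (fun t => g (Function.update x j t)) (g' x) (Icc 0 1) (x j))
    {w w' : Fin s → ℝ → ℝ} (hw : ∀ i, Measurable (w i)) (hw1 : ∀ i x, |w i x| ≤ 1)
    (hw' : ∀ i, Measurable (w' i)) (hw1' : ∀ i x, |w' i x| ≤ 1)
    (hne : ∀ i, i ≠ j → w' i = w i) {k n : ℕ} (hk : topBit k n ≠ 0)
    (hj : w j = walPrim k n) (hj' : w' j = walPrim k (n + 1)) :
    ∫ x, g x * ∏ i, w i (x i) ∂(Measure.pi fun _ => unitMeas) =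
      -∫ x, g' x * ∏ i, w' i (x i) ∂(Measure.pi fun _ => unitMeas) := by
  rw [integral_update j (hg.integrable_mul hw hw1), integral_update j (hg'.integrable_mul hw' hw1'),
    ← integral_neg]
  refine integral_congr_ae ?_
  filter_upwards [ae_cube_mem (Fin s)] with x hx
  simp_rw [prod_update_eq]
  have he : ∏ i ∈ Finset.univ.erase j, w' i (x i) = ∏ i ∈ Finset.univ.erase j, w i (x i) :=
    Finset.prod_congr rfl fun i hi => by rw [hne i (Finset.ne_of_mem_erase hi)]
  rw [he, hj, hj']
  simp_rw [← mul_assoc]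
  rw [integral_mul_const, integral_mul_const, ← neg_mul]
  congr 1
  rw [integral_unitMeas, integral_unitMeas]
  refine integral_mul_walPrim_eq (F := fun t => g (Function.update x j t))
    (F' := fun t => g' (Function.update x j t)) hk ?_ ?_
  · intro t ht
    have := hd _ (update_mem_cube hx j ht)
    simpa only [Function.update_idem, Function.update_self] using this
  · obtain ⟨G, hG, ⟨C, hC⟩, hgG⟩ := hg'
    have hm : Measurable fun t => G (Function.update x j t) :=
      hG.comp (measurable_update x)
    refine (intervalIntegrable_of_abs_le hm (fun t => hC _) 0 1).congr_uIoo ?_ 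
    intro t ht
    rw [uIoo_of_le zero_le_one] at ht
    exact (hgG (update_mem_cube hx j (Ioo_subset_Icc_self ht))).symm

lemma mixedDeriv_zero {s : ℕ} (f : (Fin s → ℝ) → ℝ) : mixedDeriv f 0 = f := by
  unfold mixedDeriv
  induction List.finRange s with
  | nil => rfl
  | cons a l ih => simp

/-- Induction on the total order of `a`: each step integrates by parts once in some variable `j`,
and the absolute value discards the sign. `HasMixedDerivs` permits the variables to be taken in any
order. -/
lemma abs_walshCoeff_eq {s α : ℕ} {f : (Fin s → ℝ) → ℝ} (hf : HasMixedDerivs f α)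
    (hbm : ∀ a : Fin s → ℕ, (∀ i, a i ≤ α) → BddMeasOnCube (mixedDeriv f a))
    {k : Fin s → ℕ} (a : Fin s → ℕ) (ha : ∀ i, a i ≤ α)
    (hk : ∀ i, ∀ m < a i, topBit (k i) m ≠ 0) :
    |walshCoeff f k| =
      |∫ x, mixedDeriv f a x * ∏ i, walPrim (k i) (a i) (x i) ∂(Measure.pi fun _ => unitMeas)| := by
  induction hn : ∑ i, a i generalizing a with
  | zero =>
    have h0 : a = 0 := by
      ext i; simpa using Finset.sum_eq_zero_iff.1 hn i (Finset.mem_univ i)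
    subst h0
    rw [mixedDeriv_zero, walshCoeff, cube_eq_pi]
    congr 1
    refine integral_congr_ae ?_
    filter_upwards [ae_cube_mem (Fin s)] with x hx
    congr 1
    exact Finset.prod_congr rfl fun i _ => (walPrim_zero (hx.1 i)).symm
  | succ n ih =>
    obtain ⟨j, hj⟩ : ∃ j, 0 < a j := by
      by_contra! h
      simp [fun i => Nat.le_zero.1 (h i)] at hn
    obtain ⟨b, rfl⟩ : ∃ b : Fin s → ℕ, a = b + Pi.single j 1 := by
      refine ⟨a - Pi.single j 1, ?_⟩
      ext i
      by_cases h : i = j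
      · subst h; simp; omega
      · simp [h]
    have hbj : ∀ i, i ≠ j → (b + Pi.single j 1 : Fin s → ℕ) i = b i := fun i hi => by simp [hi]
    have hle : ∀ i, b i ≤ (b + Pi.single j 1 : Fin s → ℕ) i := fun i => by simp
    have hbj1 : (b + Pi.single j 1 : Fin s → ℕ) j = b j + 1 := by simp
    have hsum : ∑ i, b i = n := by
      simp only [Pi.add_apply, Finset.sum_add_distrib, Finset.sum_pi_single', Finset.mem_univ,
        if_true] at hn
      omega
    rw [ih b (fun i => (hle i).trans (ha i)) (fun i m hm => hk i m (hm.trans_le (hle i))) hsum,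
      integral_cube_ibp (j := j) (k := k j) (n := b j) (hbm b fun i => (hle i).trans (ha i))
      (hbm _ ha) (w := fun i => walPrim (k i) (b i))
      (w' := fun i => walPrim (k i) ((b + Pi.single j 1 : Fin s → ℕ) i)) ?_ ?_ ?_ ?_ ?_ ?_ ?_ rfl ?_,
      abs_neg]
    · intro x hx
      refine hf b (fun i => (hle i).trans (ha i)) j ?_ x hx
      have := ha j
      omega
    · exact fun i => measurable_walPrim fun m hm => hk i m (hm.trans_le (hle i))
    · exact fun i => abs_walPrim_le fun m hm => hk i m (hm.trans_le (hle i))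
    · exact fun i => measurable_walPrim (hk i)
    · exact fun i => abs_walPrim_le (hk i)
    · intro i hi
      simp only [hbj i hi]
    · exact hk j (b j) (by omega)
    · simp only [hbj1]

/-! ### Tensor products of Bessel systems -/

/-- The family `(φ k)_{k ∈ S}` in `L²([0,1])` satisfies a Bessel inequality with constant `M`. -/
def BesselOn {ι : Type*} (φ : ι → ℝ → ℝ) (S : Finset ι) (M : ℝ) : Prop :=
  ∀ D : ℝ → ℝ, MemLp D 2 unitMeas →
    ∑ k ∈ S, (∫ x, D x * φ k x ∂unitMeas) ^ 2 ≤ M * ∫ x, D x ^ 2 ∂unitMeas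

/-- Nonnegativity of the variance. -/
lemma sq_integral_le {Ω : Type*} [MeasurableSpace Ω] {μ : Measure Ω} [IsProbabilityMeasure μ]
    {D : Ω → ℝ} (hD : MemLp D 2 μ) : (∫ x, D x ∂μ) ^ 2 ≤ ∫ x, D x ^ 2 ∂μ := by
  have h1 : Integrable D μ := hD.integrable one_le_two
  have h2 : Integrable (fun x => D x ^ 2) μ := hD.integrable_sq
  set m := ∫ x, D x ∂μ with hm
  have h3 : 0 ≤ ∫ x, (D x - m) ^ 2 ∂μ := integral_nonneg fun x => sq_nonneg _
  have h4 : ∫ x, (D x - m) ^ 2 ∂μ = ∫ x, D x ^ 2 ∂μ - 2 * m * m + m ^ 2 := by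
    have : ∀ x, (D x - m) ^ 2 = D x ^ 2 - 2 * m * D x + m ^ 2 := fun x => by ring
    simp_rw [this]
    have h5 : Integrable (fun x => 2 * m * D x) μ := h1.const_mul _
    rw [integral_add (f := fun x => D x ^ 2 - 2 * m * D x) (h2.sub h5) (integrable_const _),
      integral_sub h2 h5, integral_const_mul]
    simp [hm]
  nlinarith

lemma sum_piFinset_succ {ι : Type*} {n : ℕ} (S : Fin (n + 1) → Finset ι)
    (F : (Fin (n + 1) → ι) → ℝ) :
    ∑ k ∈ Fintype.piFinset S, F k =
      ∑ k0 ∈ S 0, ∑ k ∈ Fintype.piFinset (fun i => S (Fin.succ i)), F (Fin.cons k0 k) := by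
  rw [← Finset.sum_product']
  refine Finset.sum_nbij' (fun k => (k 0, Fin.tail k)) (fun z => Fin.cons z.1 z.2) ?_ ?_ ?_ ?_ ?_
  · intro k hk
    have := Fin.mem_piFinset_iff_zero_tail.1 hk
    exact Finset.mem_product.2 this
  · intro z hz
    rw [Finset.mem_product] at hz
    rw [Fin.mem_piFinset_iff_zero_tail]
    exact ⟨hz.1, hz.2⟩
  · intro k _; simp
  · intro z _; simp
  · intro k _; simp

/-- Induction on the dimension: integrating out the first variable against `φ 0 k` gives functions
`G k`, to which the induction hypothesis applies. Their total energy is controlled by the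
one-dimensional inequality on sections and Fubini. -/
lemma BesselOn.pi {ι : Type*} {n : ℕ} {φ : Fin n → ι → ℝ → ℝ} {S : Fin n → Finset ι}
    {M : Fin n → ℝ} (hM : ∀ j, 0 ≤ M j) (hφ : ∀ j k, k ∈ S j → Measurable (φ j k))
    (hφb : ∀ j k, k ∈ S j → ∃ C, ∀ x, |φ j k x| ≤ C) (h : ∀ j, BesselOn (φ j) (S j) (M j))
    {D : (Fin n → ℝ) → ℝ} (hD : MemLp D 2 (Measure.pi fun _ => unitMeas)) :
    ∑ k ∈ Fintype.piFinset S,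
        (∫ x, D x * ∏ j, φ j (k j) (x j) ∂(Measure.pi fun _ => unitMeas)) ^ 2 ≤
      (∏ j, M j) * ∫ x, D x ^ 2 ∂(Measure.pi fun _ => unitMeas) := by
  induction n with
  | zero =>
    have : Fintype.piFinset S = {default} := by
      ext k; simp [Subsingleton.elim k default]
    rw [this]
    simpa using sq_integral_le hD
  | succ n ih =>
    set ν : Measure (Fin n → ℝ) := Measure.pi fun _ => unitMeas with hν
    have he := (measurePreserving_piFinSuccAbove (fun _ : Fin (n + 1) => unitMeas) 0).symm
    set e := (MeasurableEquiv.piFinSuccAbove (fun _ : Fin (n + 1) => ℝ) 0).symm with hedef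
    have heval : ∀ z : ℝ × (Fin n → ℝ), e z = Fin.cons z.1 z.2 := by
      intro z; simp [hedef]; rfl
    have hD' : MemLp (fun z => D (e z)) 2 (unitMeas.prod ν) := hD.comp_measurePreserving he
    have hint : Integrable (fun z => D (e z)) (unitMeas.prod ν) := hD'.integrable one_le_two
    have hsq : Integrable (fun z => D (e z) ^ 2) (unitMeas.prod ν) := hD'.integrable_sq
    -- Sections of a square-integrable function are square integrable only for almost every `y`.
    have hsec : ∀ᵐ y ∂ν, MemLp (fun t => D (e (t, y))) 2 unitMeas := by
      filter_upwards [hint.prod_left_ae, hsq.prod_left_ae] with y h1 h2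
      exact (memLp_two_iff_integrable_sq h1.1).2 h2
    set G : ι → (Fin n → ℝ) → ℝ := fun k y => ∫ t, D (e (t, y)) * φ 0 k t ∂unitMeas with hG
    have hmulint : ∀ k ∈ S 0, Integrable (fun z => D (e z) * φ 0 k z.1) (unitMeas.prod ν) := by
      intro k hk
      obtain ⟨C, hC⟩ := hφb 0 k hk
      exact hint.mul_bdd (c := C) ((hφ 0 k hk).comp measurable_fst).aestronglyMeasurable
        (Eventually.of_forall fun z => by simpa using hC z.1)
    have hGint : ∀ k ∈ S 0, Integrable (G k) ν := fun k hk => (hmulint k hk).integral_prod_right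
    have hsum : ∀ᵐ y ∂ν, ∑ k ∈ S 0, G k y ^ 2 ≤ M 0 * ∫ t, D (e (t, y)) ^ 2 ∂unitMeas := by
      filter_upwards [hsec] with y hy
      exact h 0 _ hy
    have hRint : Integrable (fun y => M 0 * ∫ t, D (e (t, y)) ^ 2 ∂unitMeas) ν :=
      hsq.integral_prod_right.const_mul _
    have hGsq : ∀ k ∈ S 0, Integrable (fun y => G k y ^ 2) ν := by
      intro k hk
      refine hRint.mono' ((hGint k hk).1.pow 2) ?_
      filter_upwards [hsum] with y hy
      rw [Real.norm_eq_abs, abs_of_nonneg (sq_nonneg _)]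
      exact (Finset.single_le_sum (f := fun k => G k y ^ 2) (fun _ _ => sq_nonneg _) hk).trans hy
    have hGL : ∀ k ∈ S 0, MemLp (G k) 2 ν := fun k hk =>
      (memLp_two_iff_integrable_sq (hGint k hk).1).2 (hGsq k hk)
    have hfub : ∀ k0 ∈ S 0, ∀ k ∈ Fintype.piFinset (fun i => S (Fin.succ i)),
        ∫ x, D x * ∏ j, φ j ((Fin.cons k0 k : Fin (n + 1) → ι) j) (x j)
          ∂(Measure.pi fun _ => unitMeas) =
        ∫ y, G k0 y * ∏ j, φ (Fin.succ j) (k j) (y j) ∂ν := by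
      intro k0 hk0 k hk
      rw [Fintype.mem_piFinset] at hk
      rw [← he.integral_comp']
      have hb : ∃ C, ∀ y : Fin n → ℝ, |∏ j, φ (Fin.succ j) (k j) (y j)| ≤ C := by
        choose C hC using fun j => hφb (Fin.succ j) (k j) (hk j)
        refine ⟨∏ j, C j, fun y => ?_⟩
        rw [Finset.abs_prod]
        exact Finset.prod_le_prod (fun _ _ => abs_nonneg _) fun j _ => hC j _
      obtain ⟨C, hC⟩ := hb
      have hmeas : Measurable fun y : Fin n → ℝ => ∏ j, φ (Fin.succ j) (k j) (y j) :=
        Finset.measurable_fun_prod _ fun j _ => (hφ _ _ (hk j)).comp (measurable_pi_apply j)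
      have hfull : Integrable (fun z : ℝ × (Fin n → ℝ) =>
          (D (e z) * φ 0 k0 z.1) * ∏ j, φ (Fin.succ j) (k j) (z.2 j)) (unitMeas.prod ν) :=
        (hmulint k0 hk0).mul_bdd (c := C) (hmeas.comp measurable_snd).aestronglyMeasurable
          (Eventually.of_forall fun z => hC z.2)
      have hrew : ∀ z : ℝ × (Fin n → ℝ),
          D (e z) * ∏ j, φ j ((Fin.cons k0 k : Fin (n + 1) → ι) j) (e z j) =
          (D (e z) * φ 0 k0 z.1) * ∏ j, φ (Fin.succ j) (k j) (z.2 j) := by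
        intro z
        rw [Fin.prod_univ_succ, heval z]
        simp [mul_assoc]
      rw [integral_congr_ae (Eventually.of_forall hrew)]
      refine (integral_prod_symm _ hfull).trans ?_
      refine integral_congr_ae (Eventually.of_forall fun y => ?_)
      simp only [hG]
      rw [integral_mul_const]
    rw [sum_piFinset_succ]
    calc ∑ k0 ∈ S 0, ∑ k ∈ Fintype.piFinset (fun i => S (Fin.succ i)),
          (∫ x, D x * ∏ j, φ j ((Fin.cons k0 k : Fin (n + 1) → ι) j) (x j)
            ∂(Measure.pi fun _ => unitMeas)) ^ 2
        = ∑ k0 ∈ S 0, ∑ k ∈ Fintype.piFinset (fun i => S (Fin.succ i)),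
          (∫ y, G k0 y * ∏ j, φ (Fin.succ j) (k j) (y j) ∂ν) ^ 2 :=
          Finset.sum_congr rfl fun k0 hk0 => Finset.sum_congr rfl fun k hk => by
            rw [hfub k0 hk0 k hk]
      _ ≤ ∑ k0 ∈ S 0, (∏ j, M (Fin.succ j)) * ∫ y, G k0 y ^ 2 ∂ν :=
          Finset.sum_le_sum fun k0 hk0 => ih (fun j => hM _) (fun j => hφ _) (fun j => hφb _)
            (fun j => h _) (hGL k0 hk0)
      _ = (∏ j, M (Fin.succ j)) * ∫ y, ∑ k0 ∈ S 0, G k0 y ^ 2 ∂ν := by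
          rw [← Finset.mul_sum, integral_finsetSum _ hGsq]
      _ ≤ (∏ j, M (Fin.succ j)) * ∫ y, M 0 * ∫ t, D (e (t, y)) ^ 2 ∂unitMeas ∂ν := by
          refine mul_le_mul_of_nonneg_left ?_ (Finset.prod_nonneg fun _ _ => hM _)
          exact integral_mono_ae (integrable_finsetSum _ hGsq) hRint hsum
      _ = (∏ j, M j) * ∫ x, D x ^ 2 ∂(Measure.pi fun _ => unitMeas) := by
          rw [integral_const_mul, ← integral_prod_symm _ hsq, Fin.prod_univ_succ,
            he.integral_comp' (g := fun x => D x ^ 2)]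
          ring

/-! ### Integral operators with product kernels -/

/-- A measurable kernel on `[0,1]²` whose sections have `L¹`-norms at most `B`. -/
structure IsKernelOn (κ : ℝ → ℝ → ℝ) (B : ℝ) : Prop where
  measurable : Measurable (Function.uncurry κ)
  integrable_left : ∀ t ∈ Icc (0 : ℝ) 1, Integrable (fun x => κ x t) unitMeas
  integral_le : ∀ t ∈ Icc (0 : ℝ) 1, ∫ x, |κ x t| ∂unitMeas ≤ B

/-- Integrating in `x` first, the kernel sections contribute at most `B^s` uniformly in `t`, so
integrability of `D` alone justifies Fubini. -/
lemma integrable_mul_prod_kernel {s : ℕ} {κ : Fin s → ℝ → ℝ → ℝ} {B : ℝ}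
    (hκ : ∀ j, IsKernelOn (κ j) B) {w : Fin s → ℝ → ℝ} (hw : ∀ j, Measurable (w j))
    (hw1 : ∀ j x, |w j x| ≤ 1) {D : (Fin s → ℝ) → ℝ}
    (hD : Integrable D (Measure.pi fun _ => unitMeas)) :
    Integrable (Function.uncurry fun x t : Fin s → ℝ =>
        D t * ∏ j, (κ j (x j) (t j) * w j (x j)))
      ((Measure.pi fun _ => unitMeas).prod (Measure.pi fun _ => unitMeas)) := by
  have hkm : Measurable fun z : (Fin s → ℝ) × (Fin s → ℝ) =>
      ∏ j, (κ j (z.1 j) (z.2 j) * w j (z.1 j)) := by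
    refine Finset.measurable_fun_prod _ fun j _ => ?_
    have h1 : Measurable fun z : (Fin s → ℝ) × (Fin s → ℝ) => κ j (z.1 j) (z.2 j) :=
      (hκ j).measurable.comp (by fun_prop : Measurable fun z : (Fin s → ℝ) × (Fin s → ℝ) =>
        (z.1 j, z.2 j))
    have h2 : Measurable fun z : (Fin s → ℝ) × (Fin s → ℝ) => w j (z.1 j) :=
      (hw j).comp (by fun_prop)
    exact h1.mul h2
  have haesm : AEStronglyMeasurable (Function.uncurry fun x t : Fin s → ℝ =>
        D t * ∏ j, (κ j (x j) (t j) * w j (x j)))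
      ((Measure.pi fun _ => unitMeas).prod (Measure.pi fun _ => unitMeas)) :=
    hD.1.comp_snd.mul hkm.aestronglyMeasurable
  have hsec : ∀ j, ∀ t ∈ Icc (0 : ℝ) 1, Integrable (fun x => κ j x t * w j x) unitMeas := by
    intro j t ht
    exact ((hκ j).integrable_left t ht).mul_bdd (c := 1) (hw j).aestronglyMeasurable
      (Eventually.of_forall fun x => by simpa using hw1 j x)
  rw [integrable_prod_iff' haesm]
  constructor
  · filter_upwards [ae_cube_mem (Fin s)] with t ht
    exact (Integrable.fintype_prod fun j => hsec j (t j) ⟨ht.1 j, ht.2 j⟩).const_mul (D t)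
  · refine (hD.norm.mul_const (B ^ s)).mono' haesm.norm.prod_swap.integral_prod_right' ?_
    filter_upwards [ae_cube_mem (Fin s)] with t ht
    rw [Real.norm_eq_abs, abs_of_nonneg (integral_nonneg fun _ => norm_nonneg _)]
    simp only [Function.uncurry, norm_mul]
    rw [integral_const_mul]
    refine mul_le_mul_of_nonneg_left ?_ (norm_nonneg _)
    simp only [norm_prod]
    rw [integral_fintype_prod_eq_prod (fun j x => ‖κ j x (t j) * w j x‖)]
    have : ∀ j ∈ Finset.univ, ∫ x, ‖κ j x (t j) * w j x‖ ∂unitMeas ≤ B := by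
      intro j _
      have htj : t j ∈ Icc (0 : ℝ) 1 := ⟨ht.1 j, ht.2 j⟩
      refine le_trans ?_ ((hκ j).integral_le (t j) htj)
      refine integral_mono (hsec j _ htj).norm ((hκ j).integrable_left _ htj).abs fun x => ?_
      simp only [Real.norm_eq_abs, abs_mul]
      have := hw1 j x
      nlinarith [abs_nonneg (κ j x (t j)), abs_nonneg (w j x)]
    refine (Finset.prod_le_prod (fun _ _ => integral_nonneg fun _ => norm_nonneg _) this).trans ?_
    simp

lemma integral_prod_kernel_mul {s : ℕ} {κ : Fin s → ℝ → ℝ → ℝ} {B : ℝ}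
    (hκ : ∀ j, IsKernelOn (κ j) B) {w : Fin s → ℝ → ℝ} (hw : ∀ j, Measurable (w j))
    (hw1 : ∀ j x, |w j x| ≤ 1) {D : (Fin s → ℝ) → ℝ}
    (hD : Integrable D (Measure.pi fun _ => unitMeas)) :
    Integrable (fun x : Fin s → ℝ => (∫ t, D t * ∏ j, κ j (x j) (t j)
        ∂(Measure.pi fun _ => unitMeas)) * ∏ j, w j (x j)) (Measure.pi fun _ => unitMeas) ∧
    ∫ x, (∫ t, D t * ∏ j, κ j (x j) (t j) ∂(Measure.pi fun _ => unitMeas)) * ∏ j, w j (x j)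
        ∂(Measure.pi fun _ => unitMeas) =
      ∫ t, D t * ∏ j, ∫ x, κ j x (t j) * w j x ∂unitMeas ∂(Measure.pi fun _ => unitMeas) := by
  have hint := integrable_mul_prod_kernel hκ hw hw1 hD
  have hrew : ∀ x : Fin s → ℝ, (∫ t, D t * ∏ j, κ j (x j) (t j)
      ∂(Measure.pi fun _ => unitMeas)) * ∏ j, w j (x j) =
      ∫ t, D t * ∏ j, (κ j (x j) (t j) * w j (x j)) ∂(Measure.pi fun _ => unitMeas) := by
    intro x
    rw [← integral_mul_const]
    congr 1
    ext t
    rw [Finset.prod_mul_distrib, mul_assoc]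
  simp_rw [hrew]
  refine ⟨hint.integral_prod_left, ?_⟩
  rw [integral_integral_swap hint]
  refine integral_congr_ae (Eventually.of_forall fun t => ?_)
  simp only
  rw [integral_const_mul, integral_fintype_prod_eq_prod (fun j x => κ j x (t j) * w j x)]

/-! ### Convolution on the unit interval -/

lemma unitMeas_le_volume : unitMeas ≤ (volume : Measure ℝ) := Measure.restrict_le_self

lemma integrable_conv_left {k : ℝ → ℝ} (hk : Integrable k) (x : ℝ) :
    Integrable (fun t => k (x - t)) unitMeas :=
  (hk.comp_sub_left x).mono_measure unitMeas_le_volume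

lemma integrable_conv_right {k : ℝ → ℝ} (hk : Integrable k) (t : ℝ) :
    Integrable (fun x => k (x - t)) unitMeas :=
  (hk.comp_sub_right t).mono_measure unitMeas_le_volume

lemma integral_abs_conv_left_le {k : ℝ → ℝ} (hk : Integrable k) (x : ℝ) :
    ∫ t, |k (x - t)| ∂unitMeas ≤ ∫ y, |k y| := by
  rw [← integral_sub_left_eq_self (fun y => |k y|) volume x]
  exact integral_mono_measure unitMeas_le_volume (Eventually.of_forall fun _ => abs_nonneg _)
    (hk.comp_sub_left x).abs

lemma integral_abs_conv_right_le {k : ℝ → ℝ} (hk : Integrable k) (t : ℝ) :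
    ∫ x, |k (x - t)| ∂unitMeas ≤ ∫ y, |k y| := by
  rw [← integral_sub_right_eq_self (fun y => |k y|) t]
  exact integral_mono_measure unitMeas_le_volume (Eventually.of_forall fun _ => abs_nonneg _)
    (hk.comp_sub_right t).abs

lemma integrable_conv_prod {D k : ℝ → ℝ} (hD : Integrable D unitMeas) (hk : Integrable k) :
    Integrable (fun z : ℝ × ℝ => D z.2 * k (z.1 - z.2)) (volume.prod unitMeas) :=
  hD.convolution_integrand (ContinuousLinearMap.mul ℝ ℝ) hk

/-- Cauchy–Schwarz for the weight `|k (x - t)|`, read off from the discriminant of the nonnegative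
quadratic `c ↦ ∫ (|D t| - c)² |k (x - t)| dt`. -/
lemma young_pointwise {k D : ℝ → ℝ} (hk : Integrable k) {x : ℝ}
    (h1 : Integrable (fun t => D t * k (x - t)) unitMeas)
    (h2 : Integrable (fun t => D t ^ 2 * |k (x - t)|) unitMeas) :
    (∫ t, D t * k (x - t) ∂unitMeas) ^ 2 ≤
      (∫ y, |k y|) * ∫ t, D t ^ 2 * |k (x - t)| ∂unitMeas := by
  set N := ∫ t, |k (x - t)| ∂unitMeas with hN
  set P := ∫ t, |D t * k (x - t)| ∂unitMeas with hP
  set Q := ∫ t, D t ^ 2 * |k (x - t)| ∂unitMeas with hQ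
  have hkx := (integrable_conv_left hk x).abs
  have key : ∀ c : ℝ, 0 ≤ N * (c * c) + (-2 * P) * c + Q := by
    intro c
    have e : ∫ t, (|D t| - c) ^ 2 * |k (x - t)| ∂unitMeas =
        Q + (-2 * c) * P + c ^ 2 * N := by
      have : ∀ t, (|D t| - c) ^ 2 * |k (x - t)| =
          (D t ^ 2 * |k (x - t)| + (-2 * c) * |D t * k (x - t)|) + c ^ 2 * |k (x - t)| := by
        intro t
        rw [abs_mul, ← sq_abs (D t)]; ring
      simp_rw [this]
      rw [integral_add (f := fun t => D t ^ 2 * |k (x - t)| + (-2 * c) * |D t * k (x - t)|)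
        (h2.add (h1.abs.const_mul _)) (hkx.const_mul _),
        integral_add h2 (h1.abs.const_mul _), integral_const_mul, integral_const_mul]
    have h0 : 0 ≤ ∫ t, (|D t| - c) ^ 2 * |k (x - t)| ∂unitMeas :=
      integral_nonneg fun t => mul_nonneg (sq_nonneg _) (abs_nonneg _)
    nlinarith
  have hd := discrim_le_zero key
  rw [discrim] at hd
  have hPQ : P ^ 2 ≤ N * Q := by nlinarith
  have hQ0 : 0 ≤ Q := integral_nonneg fun t => mul_nonneg (sq_nonneg _) (abs_nonneg _)
  have hle : |∫ t, D t * k (x - t) ∂unitMeas| ≤ P := abs_integral_le_integral_abs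
  calc (∫ t, D t * k (x - t) ∂unitMeas) ^ 2 ≤ P ^ 2 := by
        rw [← sq_abs]; gcongr
    _ ≤ N * Q := hPQ
    _ ≤ _ := by
        gcongr
        exact integral_abs_conv_left_le hk x

/-- Young's inequality for the convolution of an `L²` function on `[0,1]` with an `L¹` kernel. -/
lemma young_sq {k D : ℝ → ℝ} (hk : Integrable k) (hD : MemLp D 2 unitMeas) :
    MemLp (fun x => ∫ t, D t * k (x - t) ∂unitMeas) 2 volume ∧
      ∫ x, (∫ t, D t * k (x - t) ∂unitMeas) ^ 2 ≤
        (∫ y, |k y|) ^ 2 * ∫ t, D t ^ 2 ∂unitMeas := by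
  have hD1 := hD.integrable one_le_two
  have hD2 := hD.integrable_sq
  have i1 := integrable_conv_prod hD1 hk
  have i2 := integrable_conv_prod hD2 hk.abs
  have hpt : ∀ᵐ x, (∫ t, D t * k (x - t) ∂unitMeas) ^ 2 ≤
      (∫ y, |k y|) * ∫ t, D t ^ 2 * |k (x - t)| ∂unitMeas := by
    filter_upwards [i1.prod_right_ae, i2.prod_right_ae] with x h1 h2
    exact young_pointwise hk h1 h2
  have i3 : Integrable fun x => (∫ y, |k y|) * ∫ t, D t ^ 2 * |k (x - t)| ∂unitMeas :=
    i2.integral_prod_left.const_mul _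
  have hm : AEStronglyMeasurable (fun x => ∫ t, D t * k (x - t) ∂unitMeas) volume :=
    i1.integral_prod_left.1
  have i4 : Integrable fun x => (∫ t, D t * k (x - t) ∂unitMeas) ^ 2 := by
    refine i3.mono' (hm.pow 2) ?_
    filter_upwards [hpt] with x hx
    rwa [Real.norm_eq_abs, abs_of_nonneg (sq_nonneg _)]
  refine ⟨(memLp_two_iff_integrable_sq hm).2 i4, ?_⟩
  refine (integral_mono_ae i4 i3 hpt).trans ?_
  rw [integral_const_mul, sq, mul_assoc]
  refine mul_le_mul_of_nonneg_left ?_ (integral_nonneg fun _ => abs_nonneg _)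
  -- After the swap, translation invariance supplies the second factor `‖k‖₁`.
  have : ∫ x, ∫ t, D t ^ 2 * |k (x - t)| ∂unitMeas =
      ∫ t, (∫ x, D t ^ 2 * |k (x - t)|) ∂unitMeas :=
    integral_integral_swap (f := fun x t => D t ^ 2 * |k (x - t)|) i2
  rw [this]
  simp_rw [integral_const_mul]
  simp_rw [integral_sub_right_eq_self (fun y => |k y|)]
  rw [integral_mul_const, mul_comm]

/-! ### The fractional kernel -/

lemma measurable_posPow (lam : ℝ) : Measurable (posPow lam) := by
  unfold posPow
  exact Measurable.ite measurableSet_Ioi (by fun_prop) measurable_const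

lemma posPow_nonneg (lam y : ℝ) : 0 ≤ posPow lam y := by
  unfold posPow; split_ifs with h
  · positivity
  · exact le_rfl

/-- The kernel `y_+^(lam-1)` cut off at `y = 1`. -/
noncomputable def truncPow (lam : ℝ) : ℝ → ℝ := (Ioc 0 1).indicator fun y => y ^ (lam - 1)

/-- The cutoff makes the kernel integrable on the line and is harmless, since `x - t ≤ 1` for points
of the unit interval. -/
lemma posPow_eq_truncPow (lam : ℝ) {y : ℝ} (hy : y ≤ 1) : posPow lam y = truncPow lam y := by
  unfold posPow truncPow
  by_cases h : 0 < y <;> simp [indicator, h, hy]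

lemma truncPow_nonneg (lam y : ℝ) : 0 ≤ truncPow lam y :=
  indicator_nonneg (fun _ hy => Real.rpow_nonneg hy.1.le _) y

lemma integrable_truncPow {lam : ℝ} (h : 0 < lam) : Integrable (truncPow lam) := by
  rw [truncPow, integrable_indicator_iff measurableSet_Ioc,
    ← intervalIntegrable_iff_integrableOn_Ioc_of_le zero_le_one]
  exact intervalIntegral.intervalIntegrable_rpow' (by linarith)

lemma integral_truncPow {lam : ℝ} (h : 0 < lam) : ∫ y, |truncPow lam y| = 1 / lam := by
  simp_rw [abs_of_nonneg (truncPow_nonneg lam _)]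
  rw [truncPow, integral_indicator measurableSet_Ioc,
    ← intervalIntegral.integral_of_le zero_le_one, integral_rpow (Or.inl (by linarith))]
  simp [h.ne']

lemma ae_posPow_sub_eq {lam x : ℝ} (hx : x ≤ 1) :
    ∀ᵐ t ∂unitMeas, posPow lam (x - t) = truncPow lam (x - t) := by
  filter_upwards [ae_unitMeas_mem] with t ht
  exact posPow_eq_truncPow lam (by linarith [ht.1])

lemma ae_posPow_sub_eq' {lam t : ℝ} (ht : 0 ≤ t) :
    ∀ᵐ x ∂unitMeas, posPow lam (x - t) = truncPow lam (x - t) := by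
  filter_upwards [ae_unitMeas_mem] with x hx
  exact posPow_eq_truncPow lam (by linarith [hx.2])

lemma integrable_posPow_sub {lam : ℝ} (h : 0 < lam) {x : ℝ} (hx : x ≤ 1) :
    Integrable (fun t => posPow lam (x - t)) unitMeas :=
  (integrable_conv_left (integrable_truncPow h) x).congr <| by
    filter_upwards [ae_posPow_sub_eq (lam := lam) hx] with t ht using ht.symm

lemma integral_posPow_sub_le {lam : ℝ} (h : 0 < lam) {x : ℝ} (hx : x ≤ 1) :
    ∫ t, posPow lam (x - t) ∂unitMeas ≤ 1 / lam := by
  rw [← integral_truncPow h]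
  refine le_trans (le_of_eq ?_) (integral_abs_conv_left_le (integrable_truncPow h) x)
  refine integral_congr_ae ?_
  filter_upwards [ae_posPow_sub_eq (lam := lam) hx] with t ht
  rw [ht, abs_of_nonneg (truncPow_nonneg _ _)]

/-- The normalized one-dimensional kernel, which is `1` for the variables outside `u`. -/
noncomputable def fracKer {s : ℕ} (lam : ℝ) (u : Finset (Fin s)) (j : Fin s) (x t : ℝ) : ℝ :=
  if j ∈ u then (Real.Gamma lam)⁻¹ * posPow lam (x - t) else 1

lemma fracKer_nonneg {s : ℕ} {lam : ℝ} (h : 0 < lam) (u : Finset (Fin s)) (j : Fin s) (x t : ℝ) :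
    0 ≤ fracKer lam u j x t := by
  unfold fracKer; split_ifs
  · have := Real.Gamma_pos_of_pos h
    exact mul_nonneg (by positivity) (posPow_nonneg _ _)
  · exact zero_le_one

lemma measurable_fracKer {s : ℕ} (lam : ℝ) (u : Finset (Fin s)) (j : Fin s) :
    Measurable (Function.uncurry (fracKer lam u j)) := by
  unfold fracKer Function.uncurry; split_ifs
  · exact ((measurable_posPow lam).comp (measurable_fst.sub measurable_snd)).const_mul _
  · exact measurable_const

lemma isKernelOn_fracKer {s : ℕ} {lam : ℝ} (h : 0 < lam) (u : Finset (Fin s)) (j : Fin s) :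
    IsKernelOn (fracKer lam u j) (1 + (Real.Gamma lam)⁻¹ * (1 / lam)) := by
  have hG := Real.Gamma_pos_of_pos h
  refine ⟨measurable_fracKer lam u j, fun t ht => ?_, fun t ht => ?_⟩
  · unfold fracKer; split_ifs
    · refine Integrable.const_mul ?_ _
      exact (integrable_conv_right (integrable_truncPow h) t).congr <| by
        filter_upwards [ae_posPow_sub_eq' (lam := lam) ht.1] with x hx using hx.symm
    · exact integrable_const _
  · simp_rw [abs_of_nonneg (fracKer_nonneg h u j _ _)]
    unfold fracKer; split_ifs
    · rw [integral_const_mul]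
      have : ∫ x, posPow lam (x - t) ∂unitMeas ≤ 1 / lam := by
        rw [← integral_truncPow h]
        refine le_trans (le_of_eq ?_) (integral_abs_conv_right_le (integrable_truncPow h) t)
        refine integral_congr_ae ?_
        filter_upwards [ae_posPow_sub_eq' (lam := lam) ht.1] with x hx
        rw [hx, abs_of_nonneg (truncPow_nonneg _ _)]
      have h1 : 0 ≤ (Real.Gamma lam)⁻¹ := by positivity
      nlinarith
    · simp; positivity

lemma posPow_rpow {lam q : ℝ} (hq : 0 < q) (y : ℝ) :
    posPow lam y ^ q = posPow ((lam - 1) * q + 1) y := by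
  unfold posPow
  split_ifs with h
  · rw [← Real.rpow_mul h.le]; congr 1; ring
  · exact Real.zero_rpow hq.ne'

lemma fracKer_rpow_integral_le {s : ℕ} {lam q : ℝ} (h : 0 < lam) (hq : 0 < q)
    (hlq : 0 < (lam - 1) * q + 1) (u : Finset (Fin s)) (j : Fin s) {x : ℝ} (hx : x ≤ 1) :
    Integrable (fun t => fracKer lam u j x t ^ q) unitMeas ∧
      ∫ t, fracKer lam u j x t ^ q ∂unitMeas ≤
        1 + (Real.Gamma lam)⁻¹ ^ q * (1 / ((lam - 1) * q + 1)) := by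
  have hG := Real.Gamma_pos_of_pos h
  have h1 : 0 ≤ (Real.Gamma lam)⁻¹ ^ q := by positivity
  unfold fracKer; split_ifs
  · have : ∀ t, ((Real.Gamma lam)⁻¹ * posPow lam (x - t)) ^ q =
        (Real.Gamma lam)⁻¹ ^ q * posPow ((lam - 1) * q + 1) (x - t) := fun t => by
      rw [Real.mul_rpow (by positivity) (posPow_nonneg _ _), posPow_rpow hq]
    simp_rw [this]
    refine ⟨(integrable_posPow_sub hlq hx).const_mul _, ?_⟩
    rw [integral_const_mul]
    have := integral_posPow_sub_le hlq hx
    nlinarith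
  · simp; positivity

/-- Hölder's inequality. The `q`-th power of the kernel is again a power kernel, with `(lam - 1) * q
+ 1` in place of `lam`, so `hlq` gives a bound uniform in `x`. -/
lemma abs_integral_mul_fracKer_le {s : ℕ} {lam p q : ℝ} (h : 0 < lam)
    (hpq : p.HolderConjugate q) (hlq : 0 < (lam - 1) * q + 1) (u : Finset (Fin s))
    {E : (Fin s → ℝ) → ℝ} (hE : MemLp E (ENNReal.ofReal p) (Measure.pi fun _ => unitMeas)) :
    ∃ C, ∀ x ∈ Icc (0 : Fin s → ℝ) 1,
      |∫ t, E t * ∏ j, fracKer lam u j (x j) (t j) ∂(Measure.pi fun _ => unitMeas)| ≤ C := by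
  set B := 1 + (Real.Gamma lam)⁻¹ ^ q * (1 / ((lam - 1) * q + 1))
  refine ⟨(∫ t, ‖E t‖ ^ p ∂(Measure.pi fun _ => unitMeas)) ^ (1 / p) * (B ^ s) ^ (1 / q),
    fun x hx => ?_⟩
  have hq : 0 < q := hpq.symm.pos
  have hk : ∀ t : Fin s → ℝ, ‖∏ j, fracKer lam u j (x j) (t j)‖ ^ q =
      ∏ j, fracKer lam u j (x j) (t j) ^ q := fun t => by
    rw [norm_prod, ← Real.finsetProd_rpow _ _ fun _ _ => norm_nonneg _]
    refine Finset.prod_congr rfl fun j _ => ?_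
    rw [Real.norm_of_nonneg (fracKer_nonneg h u j _ _)]
  have hm : Measurable fun t : Fin s → ℝ => ∏ j, fracKer lam u j (x j) (t j) :=
    Finset.measurable_fun_prod _ fun j _ => (measurable_fracKer lam u j).comp
      (by fun_prop : Measurable fun t : Fin s → ℝ => (x j, t j))
  have hj := fun j => fracKer_rpow_integral_le h hq hlq u j (hx.2 j)
  have hL : MemLp (fun t : Fin s → ℝ => ∏ j, fracKer lam u j (x j) (t j)) (ENNReal.ofReal q)
      (Measure.pi fun _ => unitMeas) := by
    rw [← integrable_norm_rpow_iff hm.aestronglyMeasurable (by simpa using hq)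
      ENNReal.ofReal_ne_top, ENNReal.toReal_ofReal hq.le]
    simp_rw [hk]
    exact Integrable.fintype_prod fun j => (hj j).1
  refine abs_integral_le_integral_abs.trans ?_
  simp_rw [abs_mul]
  refine (integral_mul_norm_le_Lp_mul_Lq hpq hE hL).trans ?_
  refine mul_le_mul_of_nonneg_left ?_ (by positivity)
  refine Real.rpow_le_rpow (integral_nonneg fun _ => by positivity) ?_ (by positivity)
  simp_rw [hk]
  rw [integral_fintype_prod_eq_prod (fun j t => fracKer lam u j (x j) t ^ q)]
  refine (Finset.prod_le_prod (fun j _ => integral_nonneg fun t =>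
    Real.rpow_nonneg (fracKer_nonneg h u j _ _) _) fun j _ => (hj j).2).trans ?_
  simp [B]

lemma prod_fracKer {s : ℕ} (lam : ℝ) (u : Finset (Fin s)) (x t : Fin s → ℝ) :
    ∏ j, fracKer lam u j (x j) (t j) =
      (Real.Gamma lam ^ u.card)⁻¹ * ∏ j : u, posPow lam (x j - t j) := by
  unfold fracKer
  rw [Finset.prod_ite_mem, Finset.univ_inter, Finset.prod_mul_distrib, Finset.prod_const, inv_pow,
    Finset.prod_coe_sort u (fun j => posPow lam (x j - t j))]

lemma IsFracDeriv.memLp_cube {s : ℕ} {lam : ℝ} {p : ℝ≥0∞} {g : (Fin s → ℝ) → ℝ}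
    {D : (u : Finset (Fin s)) → (u → ℝ) → ℝ} (h : IsFracDeriv lam p g D) (u : Finset (Fin s)) :
    MemLp (fun t : Fin s → ℝ => D u fun i => t i) p (Measure.pi fun _ => unitMeas) := by
  have := h.memLp u
  rw [cube_eq_pi] at this
  exact this.comp_measurePreserving (measurePreserving_restrict_cube u)

lemma IsFracDeriv.eq_sum {s : ℕ} {lam : ℝ} {p : ℝ≥0∞} {g : (Fin s → ℝ) → ℝ}
    {D : (u : Finset (Fin s)) → (u → ℝ) → ℝ} (h : IsFracDeriv lam p g D) {x : Fin s → ℝ}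
    (hx : x ∈ Icc (0 : Fin s → ℝ) 1) :
    g x = ∑ u : Finset (Fin s), ∫ t : Fin s → ℝ, (D u fun i => t i) *
      ∏ j, fracKer lam u j (x j) (t j) ∂(Measure.pi fun _ => unitMeas) := by
  rw [h.repr x hx]
  refine Finset.sum_congr rfl fun u _ => ?_
  have hmp := measurePreserving_restrict_cube u
  have hD := h.memLp u
  rw [cube_eq_pi] at hD ⊢
  have hm : Measurable fun t : u → ℝ => ∏ j : u, posPow lam (x j - t j) :=
    Finset.measurable_fun_prod _ fun j _ => (measurable_posPow lam).comp (by fun_prop)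
  have := integral_map (f := fun t : u → ℝ => D u t * ∏ j : u, posPow lam (x j - t j))
    hmp.measurable.aemeasurable (by
      rw [hmp.map_eq]; exact hD.1.mul hm.aestronglyMeasurable)
  rw [hmp.map_eq] at this
  rw [this, ← integral_const_mul]
  congr 1
  ext t
  rw [prod_fracKer]
  ring

/-- The condition `p > 1/lam` enters here: it makes the mixed derivatives bounded, hence integrable,
as integration by parts requires. -/
lemma IsFracDeriv.bddMeasOnCube {s : ℕ} {lam : ℝ} (hlam : 0 < lam) {p : ℝ≥0∞} (hp : 2 ≤ p)
    (hlp : ENNReal.ofReal lam⁻¹ < p) {g : (Fin s → ℝ) → ℝ}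
    {D : (u : Finset (Fin s)) → (u → ℝ) → ℝ} (h : IsFracDeriv lam p g D) : BddMeasOnCube g := by
  -- Since `p` may be infinite, a real `r` with `max 1 (1/lam) < r < p` is chosen; its conjugate `q`
  -- satisfies `(lam - 1) q + 1 = (lam r - 1)/(r - 1) > 0`.
  obtain ⟨r, hr0, hr1, hr2⟩ := ENNReal.lt_iff_exists_real_btwn.1
    (max_lt (ENNReal.one_lt_two.trans_le hp) hlp)
  rw [max_lt_iff] at hr1
  have h1r : 1 < r := by simpa using hr1.1
  have hlr : lam⁻¹ < r := (ENNReal.ofReal_lt_ofReal_iff (by linarith)).1 hr1.2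
  have hpq := Real.HolderConjugate.conjExponent h1r
  have hlq : 0 < (lam - 1) * r.conjExponent + 1 := by
    unfold Real.conjExponent
    have h2 : 1 < lam * r := by
      rwa [inv_eq_one_div, div_lt_iff₀' hlam] at hlr
    have h3 : 0 < r - 1 := by linarith
    have : (lam - 1) * (r / (r - 1)) + 1 = (lam * r - 1) / (r - 1) := by field_simp; ring
    rw [this]
    exact div_pos (by linarith) h3
  have hE : ∀ u, MemLp (fun t : Fin s → ℝ => D u fun i => t i) (ENNReal.ofReal r)
      (Measure.pi fun _ => unitMeas) := fun u => (h.memLp_cube u).mono_exponent hr2.le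
  choose C hC using fun u => abs_integral_mul_fracKer_le hlam hpq hlq u (hE u)
  -- Strongly measurable representatives of the `D_u` make the candidate measurable without changing
  -- the integrals.
  refine ⟨(Icc (0 : Fin s → ℝ) 1).indicator fun x => ∑ u : Finset (Fin s), ∫ t : Fin s → ℝ,
    (hE u).1.mk _ t * ∏ j, fracKer lam u j (x j) (t j) ∂(Measure.pi fun _ => unitMeas), ?_, ?_, ?_⟩
  · refine Measurable.indicator ?_ measurableSet_Icc
    refine Finset.measurable_fun_sum _ fun u _ => StronglyMeasurable.measurable ?_
    refine StronglyMeasurable.integral_prod_right (f := fun x t : Fin s → ℝ =>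
      (hE u).1.mk _ t * ∏ j, fracKer lam u j (x j) (t j)) ?_
    refine StronglyMeasurable.mul ((hE u).1.stronglyMeasurable_mk.comp_measurable measurable_snd) ?_
    refine Measurable.stronglyMeasurable ?_
    exact Finset.measurable_fun_prod _ fun j _ => (measurable_fracKer lam u j).comp
      (by fun_prop : Measurable fun z : (Fin s → ℝ) × (Fin s → ℝ) => (z.1 j, z.2 j))
  all_goals
    have hmk : ∀ u, ∀ x : Fin s → ℝ, ∫ t : Fin s → ℝ, (hE u).1.mk _ t *
        ∏ j, fracKer lam u j (x j) (t j) ∂(Measure.pi fun _ => unitMeas) =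
        ∫ t : Fin s → ℝ, (D u fun i => t i) *
        ∏ j, fracKer lam u j (x j) (t j) ∂(Measure.pi fun _ => unitMeas) := by
      intro u x
      refine integral_congr_ae ?_
      filter_upwards [(hE u).1.ae_eq_mk] with t ht
      rw [ht]
    simp_rw [hmk]
  · refine ⟨∑ u, |C u|, fun x => ?_⟩
    by_cases hx : x ∈ Icc (0 : Fin s → ℝ) 1
    · rw [indicator_of_mem hx]
      exact (Finset.abs_sum_le_sum_abs _ _).trans
        (Finset.sum_le_sum fun u _ => (hC u x hx).trans (le_abs_self _))
    · rw [indicator_of_notMem hx, abs_zero]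
      exact Finset.sum_nonneg fun _ _ => abs_nonneg _
  · intro x hx
    rw [indicator_of_mem hx]
    exact h.eq_sum hx

/-! ### Bessel's inequality for Walsh functions -/

lemma mem_bitSet {k l : ℕ} : l ∈ bitSet k ↔ 1 ≤ l ∧ k.testBit (l - 1) = true := by
  simp only [bitSet, Finset.mem_filter, Finset.mem_Icc]
  constructor
  · exact fun h => ⟨h.1.1, h.2⟩
  · rintro ⟨h1, h2⟩
    have h3 := Nat.ge_two_pow_of_testBit h2
    have h4 : l - 1 < 2 ^ (l - 1) := Nat.lt_two_pow_self
    exact ⟨⟨h1, by omega⟩, h2⟩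

lemma bitSet_injective : Function.Injective bitSet := by
  intro k k' h
  refine Nat.eq_of_testBit_eq fun i => ?_
  have : i + 1 ∈ bitSet k ↔ i + 1 ∈ bitSet k' := by rw [h]
  simp only [mem_bitSet, Nat.add_sub_cancel, Nat.le_add_left, true_and] at this
  exact Bool.eq_iff_iff.2 this

/-- Among indices sharing their top bits, distinct ones leave distinct remaining sets, which
therefore index an orthonormal family. -/
lemma eq_of_remBits_eq {k k' n : ℕ} (hk : ∀ i < n, topBit k i ≠ 0)
    (hb : ∀ i < n, topBit k i = topBit k' i) (h : remBits k n = remBits k' n) : k = k' := by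
  induction n with
  | zero => rw [remBits_zero, remBits_zero] at h; exact bitSet_injective h
  | succ n ih =>
    refine ih (fun i hi => hk i (by omega)) (fun i hi => hb i (by omega)) ?_
    have h1 := hk n (by omega)
    have h2 := hb n (by omega)
    have h3 : topBit k' n ≠ 0 := h2 ▸ h1
    rw [remBits_eq_insert h1, remBits_eq_insert h3, h, h2]

/-- Expansion of `∫ (g - ∑ c_k r_k)² ≥ 0` with `r_k` the orthonormal products. -/
lemma bessel_radProd {ι : Type*} {S : Finset ι} {R : ι → Finset ℕ}
    (hinj : ∀ k ∈ S, ∀ k' ∈ S, R k = R k' → k = k') (hR : ∀ k ∈ S, ∀ b ∈ R k, 1 ≤ b)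
    {g : ℝ → ℝ} (hg : MemLp g 2 unitMeas) :
    ∑ k ∈ S, (∫ x, g x * radProd (R k) x ∂unitMeas) ^ 2 ≤ ∫ x, g x ^ 2 ∂unitMeas := by
  classical
  set c : ι → ℝ := fun k => ∫ x, g x * radProd (R k) x ∂unitMeas with hc
  have hg1 := hg.integrable one_le_two
  have i1 : ∀ k, Integrable (fun x => g x * radProd (R k) x) unitMeas := fun k =>
    hg1.mul_bdd (c := 1) (measurable_radProd _).aestronglyMeasurable
      (Eventually.of_forall fun x => (abs_radProd _ x).le)
  have i2 : ∀ k l, Integrable (fun x => radProd (R k) x * radProd (R l) x) unitMeas := fun k l =>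
    Integrable.of_bound (C := 1) (by fun_prop)
      (Eventually.of_forall fun x => by simp [abs_radProd])
  have i3 : Integrable (fun x => ∑ k ∈ S, 2 * c k * (g x * radProd (R k) x)) unitMeas :=
    integrable_finsetSum _ fun k _ => (i1 k).const_mul _
  have i4 : Integrable (fun x => ∑ k ∈ S, ∑ l ∈ S,
      c k * c l * (radProd (R k) x * radProd (R l) x)) unitMeas :=
    integrable_finsetSum _ fun k _ => integrable_finsetSum _ fun l _ => (i2 k l).const_mul _
  have e0 : ∀ x, (g x - ∑ k ∈ S, c k * radProd (R k) x) ^ 2 =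
      (g x ^ 2 - ∑ k ∈ S, 2 * c k * (g x * radProd (R k) x)) + ∑ k ∈ S, ∑ l ∈ S,
        c k * c l * (radProd (R k) x * radProd (R l) x) := by
    intro x
    have a1 : ∑ k ∈ S, 2 * c k * (g x * radProd (R k) x) =
        2 * g x * ∑ k ∈ S, c k * radProd (R k) x := by
      rw [Finset.mul_sum]; exact Finset.sum_congr rfl fun k _ => by ring
    have a2 : ∑ k ∈ S, ∑ l ∈ S, c k * c l * (radProd (R k) x * radProd (R l) x) =
        (∑ k ∈ S, c k * radProd (R k) x) ^ 2 := by
      rw [sq, Finset.sum_mul_sum]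
      exact Finset.sum_congr rfl fun k _ => Finset.sum_congr rfl fun l _ => by ring
    rw [a1, a2]; ring
  have h0 : 0 ≤ ∫ x, (g x - ∑ k ∈ S, c k * radProd (R k) x) ^ 2 ∂unitMeas :=
    integral_nonneg fun x => sq_nonneg _
  simp_rw [e0] at h0
  rw [integral_add (f := fun x => g x ^ 2 - ∑ k ∈ S, 2 * c k * (g x * radProd (R k) x))
    (hg.integrable_sq.sub i3) i4, integral_sub hg.integrable_sq i3,
    integral_finsetSum _ fun k _ => (i1 k).const_mul _,
    integral_finsetSum _ fun k _ => integrable_finsetSum _ fun l _ => (i2 k l).const_mul _] at h0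
  have e1 : ∀ k ∈ S, ∫ x, ∑ l ∈ S, c k * c l * (radProd (R k) x * radProd (R l) x) ∂unitMeas =
      c k ^ 2 := by
    intro k hk
    rw [integral_finsetSum _ fun l _ => (i2 k l).const_mul _]
    have : ∀ l ∈ S, ∫ x, c k * c l * (radProd (R k) x * radProd (R l) x) ∂unitMeas =
        if k = l then c k * c l else 0 := by
      intro l hl
      rw [integral_const_mul, integral_unitMeas, integral_radProd_mul_radProd (hR k hk) (hR l hl)]
      by_cases h : k = l
      · simp [h]
      · rw [if_neg h, if_neg fun h' => h (hinj k hk l hl h'), mul_zero]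
    rw [Finset.sum_congr rfl this, Finset.sum_ite_eq, if_pos hk, sq]
  have e2 : ∀ k ∈ S, ∫ x, 2 * c k * (g x * radProd (R k) x) ∂unitMeas = 2 * c k ^ 2 := by
    intro k _
    rw [integral_const_mul, sq, ← mul_assoc]
  rw [Finset.sum_congr rfl e1, Finset.sum_congr rfl e2, ← Finset.mul_sum] at h0
  linarith

/-! ### Differences at dyadic distance -/

/-- The left halves of the dyadic intervals of length `2^(1-l)` in `[0,1)`. -/
def leftHalves (l : ℕ) : Set ℝ := {x | x ∈ Ico (0 : ℝ) 1 ∧ rad l x = 1}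

lemma measurableSet_leftHalves (l : ℕ) : MeasurableSet (leftHalves l) :=
  measurableSet_Ico.inter (measurable_rad l (measurableSet_singleton 1))

lemma even_floor_of_rad {l : ℕ} {x : ℝ} (h : rad l x = 1) : Even ⌊(2 : ℝ) ^ l * x⌋ := by
  unfold rad at h; split_ifs at h with h'
  · exact h'
  · norm_num at h

/-- The floor of `2^l x` and `2^l` are both even, so the floor is at most `2^l - 2`, which leaves
room for the shift. -/
lemma add_half_pow_lt_one {l : ℕ} (hl : 1 ≤ l) {x : ℝ} (h : x ∈ leftHalves l) :
    x + (1 / 2) ^ l < 1 := by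
  obtain ⟨m, hm⟩ := even_floor_of_rad h.2
  have hp : (0 : ℝ) < 2 ^ l := by positivity
  have h1 : (⌊(2 : ℝ) ^ l * x⌋ : ℝ) ≤ 2 ^ l * x := Int.floor_le _
  have h2 : (2 : ℝ) ^ l * x < ⌊(2 : ℝ) ^ l * x⌋ + 1 := Int.lt_floor_add_one _
  have h3 : (2 : ℝ) ^ l * x < 2 ^ l := by nlinarith [h.1.2]
  obtain ⟨d, rfl⟩ : ∃ d, l = d + 1 := ⟨l - 1, by omega⟩
  have h4 : ⌊(2 : ℝ) ^ (d + 1) * x⌋ < 2 ^ (d + 1) := by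
    have : (⌊(2 : ℝ) ^ (d + 1) * x⌋ : ℝ) < ((2 ^ (d + 1) : ℤ) : ℝ) := by push_cast; linarith
    exact_mod_cast this
  have h5 : ⌊(2 : ℝ) ^ (d + 1) * x⌋ + 2 ≤ 2 ^ (d + 1) := by
    rw [hm] at h4 ⊢
    rw [pow_succ] at h4 ⊢
    omega
  have h6 : (⌊(2 : ℝ) ^ (d + 1) * x⌋ : ℝ) + 2 ≤ 2 ^ (d + 1) := by exact_mod_cast h5
  have hb : (2 : ℝ) ^ (d + 1) * (1 / 2) ^ (d + 1) = 1 := by rw [← mul_pow]; norm_num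
  have h7 : (2 : ℝ) ^ (d + 1) * (x + (1 / 2) ^ (d + 1)) < 2 ^ (d + 1) * 1 := by
    rw [mul_add, hb]; linarith
  exact lt_of_mul_lt_mul_left h7 hp.le

lemma mem_leftHalves_iff {l : ℕ} (hl : 1 ≤ l) (x : ℝ) :
    x ∈ leftHalves l ↔ x + (1 / 2) ^ l ∈ Ico (0 : ℝ) 1 ∧ rad l (x + (1 / 2) ^ l) = -1 := by
  have hpos : (0 : ℝ) < (1 / 2) ^ l := by positivity
  constructor
  · intro h
    refine ⟨⟨by linarith [h.1.1], add_half_pow_lt_one hl h⟩, ?_⟩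
    rw [rad_antiperiodic, h.2]
  · rintro ⟨⟨h1, h2⟩, h3⟩
    rw [rad_antiperiodic, neg_inj] at h3
    refine ⟨⟨?_, by linarith⟩, h3⟩
    -- A point of `[-2^(-l), 0)` has floor -1 at level `l`, which is odd.
    by_contra h4
    push Not at h4
    have hb : (2 : ℝ) ^ l * (1 / 2) ^ l = 1 := by rw [← mul_pow]; norm_num
    have hp : (0 : ℝ) < 2 ^ l := by positivity
    have : ⌊(2 : ℝ) ^ l * x⌋ = -1 := by
      rw [Int.floor_eq_iff]
      push_cast
      constructor <;> nlinarith
    have h5 := even_floor_of_rad h3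
    rw [this] at h5
    exact absurd h5 (by decide)

/-- The factor of level `l` is 1 on left halves and -1 on right halves. Translating the right halves
onto the left ones preserves `T` and the coarser factors, so only the difference of `g` remains. -/
lemma integral_mul_radProd_insert {l : ℕ} (hl : 1 ≤ l) {R : Finset ℕ} (hR : ∀ c ∈ R, c < l)
    {g : ℝ → ℝ} (hg : Integrable g) {T : ℝ → ℝ} (hT : Measurable T) {C : ℝ}
    (hC : ∀ x, |T x| ≤ C) (hp : Function.Periodic T ((1 / 2) ^ l)) :
    ∫ x, g x * (T x * radProd (insert l R) x) ∂unitMeas =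
      ∫ x, ((leftHalves l).indicator (fun x => g x - g (x + (1 / 2) ^ l)) x * T x) *
        radProd R x ∂unitMeas := by
  set h : ℝ := (1 / 2) ^ l with hh
  set A := leftHalves l with hA
  set B : Set ℝ := {x | x ∈ Ico (0 : ℝ) 1 ∧ rad l x = -1} with hB
  have hmA : MeasurableSet A := measurableSet_leftHalves l
  have hmB : MeasurableSet B :=
    measurableSet_Ico.inter (measurable_rad l (measurableSet_singleton (-1)))
  have hlR : l ∉ R := fun h' => lt_irrefl _ (hR l h')
  set q : ℝ → ℝ := fun x => g x * (T x * radProd R x) with hq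
  have hqi : Integrable q := by
    refine hg.mul_bdd (c := C) (Measurable.aestronglyMeasurable (by fun_prop))
      (Eventually.of_forall fun x => ?_)
    rw [Real.norm_eq_abs, abs_mul, abs_radProd, mul_one]; exact hC x
  have hABd : ∀ x ∈ A, x ∉ B := by
    rintro x ⟨_, h1⟩ ⟨_, h2⟩
    rw [h1] at h2; norm_num at h2
  have e1 : ∫ x, g x * (T x * radProd (insert l R) x) ∂unitMeas =
      ∫ x, (A.indicator q x - B.indicator q x) := by
    rw [unitMeas, integral_Icc_eq_integral_Ico, ← integral_indicator measurableSet_Ico]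
    congr 1
    ext x
    by_cases hx : x ∈ Ico (0 : ℝ) 1
    · rw [indicator_of_mem hx, radProd_insert hlR]
      rcases rad_eq_one_or l x with hr | hr
      · have hxA : x ∈ A := ⟨hx, hr⟩
        rw [indicator_of_mem hxA, indicator_of_notMem (hABd x hxA), hr]
        simp only [hq]; ring
      · have hxB : x ∈ B := ⟨hx, hr⟩
        rw [indicator_of_mem hxB, indicator_of_notMem fun h' => hABd x h' hxB, hr]
        simp only [hq]; ring
    · rw [indicator_of_notMem hx, indicator_of_notMem fun h' => hx h'.1,
        indicator_of_notMem fun h' => hx h'.1, sub_zero]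
  have e2 : ∀ x, B.indicator q (x + h) =
      A.indicator (fun x => g (x + h) * (T x * radProd R x)) x := by
    intro x
    by_cases hx : x ∈ A
    · have hxB : x + h ∈ B := (mem_leftHalves_iff hl x).1 hx
      rw [indicator_of_mem hx, indicator_of_mem hxB]
      simp only [hq]
      rw [hp x]
      congr 2
      exact Finset.prod_congr rfl fun c hc => rad_add_half_pow (hR c hc) hx.2
    · have hxB : x + h ∉ B := fun h' => hx ((mem_leftHalves_iff hl x).2 h')
      rw [indicator_of_notMem hx, indicator_of_notMem hxB]
  rw [e1, integral_sub (hqi.indicator hmA) (hqi.indicator hmB),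
    ← integral_add_right_eq_self (fun x => B.indicator q x) h,
    ← integral_sub (hqi.indicator hmA) ((hqi.indicator hmB).comp_add_right h)]
  rw [unitMeas, integral_Icc_eq_integral_Ico, ← integral_indicator measurableSet_Ico]
  congr 1
  ext x
  rw [e2]
  by_cases hx : x ∈ A
  · rw [indicator_of_mem hx, indicator_of_mem hx, indicator_of_mem hx.1, indicator_of_mem hx]
    simp only [hq]; ring
  · rw [indicator_of_notMem hx, indicator_of_notMem hx, sub_zero]
    by_cases hx' : x ∈ Ico (0 : ℝ) 1
    · rw [indicator_of_mem hx', indicator_of_notMem hx, zero_mul, zero_mul]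
    · rw [indicator_of_notMem hx']

/-- The difference kernel `y_+^(lam-1) - (y+h)_+^(lam-1)`, cut off at `y = 1 - h`. -/
noncomputable def diffKer (lam h : ℝ) : ℝ → ℝ :=
  (Iic (1 - h)).indicator fun y => truncPow lam y - truncPow lam (y + h)

lemma integrable_diffKer {lam : ℝ} (hlam : 0 < lam) (h : ℝ) : Integrable (diffKer lam h) :=
  ((integrable_truncPow hlam).sub ((integrable_truncPow hlam).comp_add_right h)).indicator
    measurableSet_Iic

/-- On `(-h, 0]` only the shifted power is present, and on `(0, 1 - h]` the power is nonincreasing,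
which fixes the sign. The cutoff discards `(1 - h, 1]`, where truncation would leave the unshifted
power alone and double the norm when `lam = 1`. -/
lemma integral_abs_diffKer {lam h : ℝ} (hlam : 0 < lam) (hlam1 : lam ≤ 1) (h0 : 0 < h)
    (h1 : h ≤ 1) :
    ∫ y, |diffKer lam h y| = (h ^ lam + ((1 - h) ^ lam - 1 + h ^ lam)) / lam := by
  have hr : -1 < lam - 1 := by linarith
  have e : ∀ y, |diffKer lam h y| =
      (Ioc (-h) 0).indicator (fun y => (y + h) ^ (lam - 1)) y +
      (Ioc 0 (1 - h)).indicator (fun y => y ^ (lam - 1) - (y + h) ^ (lam - 1)) y := by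
    intro y
    unfold diffKer truncPow
    rcases le_or_gt y (-h) with hy | hy
    · have a1 : y ∉ Ioc (-h) 0 := fun h' => absurd h'.1 (not_lt.2 hy)
      have a2 : y ∉ Ioc 0 (1 - h) := fun h' => by linarith [h'.1]
      have a3 : y ∉ Ioc (0 : ℝ) 1 := fun h' => by linarith [h'.1]
      have a4 : y + h ∉ Ioc (0 : ℝ) 1 := fun h' => by linarith [h'.1]
      have a5 : y ∈ Iic (1 - h) := by simp only [mem_Iic]; linarith
      rw [indicator_of_mem a5, indicator_of_notMem a3, indicator_of_notMem a4,
        indicator_of_notMem a1, indicator_of_notMem a2]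
      simp
    rcases le_or_gt y 0 with hy0 | hy0
    · have a1 : y ∈ Ioc (-h) 0 := ⟨hy, hy0⟩
      have a2 : y ∉ Ioc 0 (1 - h) := fun h' => by linarith [h'.1]
      have a3 : y ∉ Ioc (0 : ℝ) 1 := fun h' => by linarith [h'.1]
      have a4 : y + h ∈ Ioc (0 : ℝ) 1 := ⟨by linarith, by linarith⟩
      have a5 : y ∈ Iic (1 - h) := by simp only [mem_Iic]; linarith
      rw [indicator_of_mem a5, indicator_of_notMem a3, indicator_of_mem a4, indicator_of_mem a1,
        indicator_of_notMem a2, zero_sub, abs_neg, add_zero,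
        abs_of_nonneg (Real.rpow_nonneg (by linarith) _)]
    rcases le_or_gt y (1 - h) with hy1 | hy1
    · have a1 : y ∉ Ioc (-h) 0 := fun h' => by linarith [h'.2]
      have a2 : y ∈ Ioc 0 (1 - h) := ⟨hy0, hy1⟩
      have a3 : y ∈ Ioc (0 : ℝ) 1 := ⟨hy0, by linarith⟩
      have a4 : y + h ∈ Ioc (0 : ℝ) 1 := ⟨by linarith, by linarith⟩
      have a5 : y ∈ Iic (1 - h) := hy1
      rw [indicator_of_mem a5, indicator_of_mem a3, indicator_of_mem a4, indicator_of_notMem a1,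
        indicator_of_mem a2, zero_add, abs_of_nonneg]
      exact sub_nonneg.2 (Real.rpow_le_rpow_of_nonpos hy0 (by linarith) (by linarith))
    · have a1 : y ∉ Ioc (-h) 0 := fun h' => by linarith [h'.2]
      have a2 : y ∉ Ioc 0 (1 - h) := fun h' => by linarith [h'.2]
      have a5 : y ∉ Iic (1 - h) := fun h' => by linarith [mem_Iic.1 h']
      rw [indicator_of_notMem a5, indicator_of_notMem a1, indicator_of_notMem a2]; simp
  have j1 : ∀ a b : ℝ, IntervalIntegrable (fun y : ℝ => y ^ (lam - 1)) volume a b :=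
    fun a b => intervalIntegral.intervalIntegrable_rpow' hr
  have j2 : ∀ a b : ℝ, IntervalIntegrable (fun y : ℝ => (y + h) ^ (lam - 1)) volume a b := by
    intro a b
    simpa using (j1 (a + h) (b + h)).comp_add_right h
  have j3 : ∀ a b : ℝ,
      IntervalIntegrable (fun y : ℝ => y ^ (lam - 1) - (y + h) ^ (lam - 1)) volume a b :=
    fun a b => (j1 a b).sub (j2 a b)
  have k2 := (j2 (-h) 0).1
  have k3 := (j3 0 (1 - h)).1
  simp_rw [e]
  rw [integral_add ((integrable_indicator_iff measurableSet_Ioc).2 k2)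
    ((integrable_indicator_iff measurableSet_Ioc).2 k3), integral_indicator measurableSet_Ioc,
    integral_indicator measurableSet_Ioc,
    ← intervalIntegral.integral_of_le (by linarith : -h ≤ 0),
    ← intervalIntegral.integral_of_le (by linarith : (0 : ℝ) ≤ 1 - h),
    intervalIntegral.integral_sub (j1 _ _) (j2 _ _),
    intervalIntegral.integral_comp_add_right (fun y : ℝ => y ^ (lam - 1)),
    intervalIntegral.integral_comp_add_right (fun y : ℝ => y ^ (lam - 1)),
    integral_rpow (Or.inl hr), integral_rpow (Or.inl hr), integral_rpow (Or.inl hr)]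
  simp only [neg_add_cancel, zero_add, sub_add_cancel, Real.one_rpow, Real.zero_rpow hlam.ne']
  ring

/-! ### The one-dimensional estimates -/

/-- The (unnormalized) fractional integral of `D`. -/
noncomputable def fracInt (lam : ℝ) (D : ℝ → ℝ) (x : ℝ) : ℝ :=
  ∫ t, D t * truncPow lam (x - t) ∂unitMeas

lemma fracInt_integrable {lam : ℝ} (hlam : 0 < lam) {D : ℝ → ℝ} (hD : MemLp D 2 unitMeas) :
    Integrable (fracInt lam D) :=
  (integrable_conv_prod (hD.integrable one_le_two) (integrable_truncPow hlam)).integral_prod_left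

lemma fracInt_memLp {lam : ℝ} (hlam : 0 < lam) {D : ℝ → ℝ} (hD : MemLp D 2 unitMeas) :
    MemLp (fracInt lam D) 2 unitMeas :=
  (young_sq (integrable_truncPow hlam) hD).1.mono_measure unitMeas_le_volume

lemma integral_fracInt_sq_le {lam : ℝ} (hlam : 0 < lam) {D : ℝ → ℝ} (hD : MemLp D 2 unitMeas) :
    ∫ x, fracInt lam D x ^ 2 ∂unitMeas ≤ (1 / lam) ^ 2 * ∫ t, D t ^ 2 ∂unitMeas := by
  have h := young_sq (integrable_truncPow hlam) hD
  rw [integral_truncPow hlam] at h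
  exact (integral_mono_measure unitMeas_le_volume (Eventually.of_forall fun _ => sq_nonneg _)
    h.1.integrable_sq).trans h.2

/-- Fubini: the kernel is moved from the test function to `D`. -/
lemma integral_mul_posPow_swap {lam : ℝ} (hlam : 0 < lam) {D w : ℝ → ℝ}
    (hD : MemLp D 2 unitMeas) (hw : Measurable w) (hw1 : ∀ x, |w x| ≤ 1) :
    ∫ t, D t * ∫ x, (Real.Gamma lam)⁻¹ * posPow lam (x - t) * w x ∂unitMeas ∂unitMeas =
      (Real.Gamma lam)⁻¹ * ∫ x, fracInt lam D x * w x ∂unitMeas := by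
  have h1 := (integrable_conv_prod (hD.integrable one_le_two)
    (integrable_truncPow hlam)).mono_measure
    (Measure.prod_mono unitMeas_le_volume le_rfl : unitMeas.prod unitMeas ≤ _)
  have h2 : Integrable (Function.uncurry fun x t : ℝ => D t * truncPow lam (x - t) * w x)
      (unitMeas.prod unitMeas) :=
    h1.mul_bdd (c := 1) (hw.comp measurable_fst).aestronglyMeasurable
      (Eventually.of_forall fun z => hw1 z.1)
  have e1 : ∀ x, fracInt lam D x * w x =
      ∫ t, D t * truncPow lam (x - t) * w x ∂unitMeas := fun x => by
    rw [integral_mul_const]; rfl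
  simp_rw [e1]
  rw [integral_integral_swap h2, ← integral_const_mul]
  refine integral_congr_ae ?_
  filter_upwards [ae_unitMeas_mem] with t ht
  rw [← integral_const_mul, ← integral_const_mul]
  refine integral_congr_ae ?_
  filter_upwards [ae_posPow_sub_eq' (lam := lam) ht.1] with x hx
  rw [hx]; ring

lemma walPrim_zero_eq (k : ℕ) (x : ℝ) : walPrim k 0 x = radProd (bitSet k) x := by
  simp [walPrim, iterPrim, remBits_zero]

lemma bessel_walPrim_zero (S : Finset ℕ) {g : ℝ → ℝ} (hg : MemLp g 2 unitMeas) :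
    ∑ k ∈ S, (∫ x, g x * walPrim k 0 x ∂unitMeas) ^ 2 ≤ ∫ x, g x ^ 2 ∂unitMeas := by
  simp_rw [walPrim_zero_eq]
  exact bessel_radProd (fun k _ k' _ h => bitSet_injective h)
    (fun k _ b hb => one_le_of_mem_bitSet hb) hg

/-- At least one Rademacher factor remains, and the iterated primitive has its step `2^(-b)` as a
period. This removes every `u` that omits a variable with `ℓ_j ≥ 1`. -/
lemma integral_walPrim_eq_zero {k n : ℕ} (h : topBit k n ≠ 0) :
    ∫ x, walPrim k n x ∂unitMeas = 0 := by
  have h0 : ∀ i < n, topBit k i ≠ 0 := fun i hi => topBit_ne_zero_of_le (by omega : i ≤ n) h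
  obtain ⟨h1, h2, h3⟩ := iterPrim_measurable_bounded _ n (topBit_strictAnti h0)
  rw [integral_unitMeas]
  refine integral_mul_radProd_eq_zero h1 h3 ?_ (fun b hb => one_le_of_mem_bitSet
    (remBits_subset k n hb)) fun b hb => h2 b fun i hi => ?_
  · rw [remBits_eq_insert h]; exact Finset.insert_nonempty _ _
  · have h4 := topBit_lt hi h
    rw [remBits_eq_insert h, Finset.mem_insert] at hb
    rcases hb with rfl | hb
    · exact h4
    · exact (lt_topBit_of_mem_remBits h hb).trans h4

/-- The differences of `fracInt lam D` at distance `2^(-l)`. -/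
noncomputable def fracDiff (lam : ℝ) (D : ℝ → ℝ) (l : ℕ) : ℝ → ℝ :=
  (leftHalves l).indicator fun x => fracInt lam D x - fracInt lam D (x + (1 / 2) ^ l)

/-- On left halves `x - t ≤ 1 - h`, so the difference is the convolution with `diffKer` and Young's
inequality applies. The identity is obtained for almost every `x`, where both convolutions converge
absolutely. -/
lemma fracDiff_memLp_and_sq_le {lam : ℝ} (hlam : 0 < lam) {D : ℝ → ℝ} (hD : MemLp D 2 unitMeas)
    {l : ℕ} (hl : 1 ≤ l) :
    MemLp (fracDiff lam D l) 2 unitMeas ∧ ∫ x, fracDiff lam D l x ^ 2 ∂unitMeas ≤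
      (∫ y, |diffKer lam ((1 / 2) ^ l) y|) ^ 2 * ∫ t, D t ^ 2 ∂unitMeas := by
  set h : ℝ := (1 / 2) ^ l with hh
  have hk := integrable_diffKer hlam h
  have hY := young_sq hk hD
  have hT := integrable_truncPow hlam
  have i1 := integrable_conv_prod (hD.integrable one_le_two) hT
  have i2 := integrable_conv_prod (hD.integrable one_le_two) (hT.comp_add_right h)
  have hae : fracDiff lam D l =ᵐ[volume]
      (leftHalves l).indicator fun x => ∫ t, D t * diffKer lam h (x - t) ∂unitMeas := by
    filter_upwards [i1.prod_right_ae, i2.prod_right_ae] with x h1 h2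
    unfold fracDiff
    by_cases hx : x ∈ leftHalves l
    · rw [indicator_of_mem hx, indicator_of_mem hx]
      unfold fracInt
      have e : ∀ t, truncPow lam (x + (1 / 2) ^ l - t) = truncPow lam (x - t + h) := fun t => by
        congr 1; ring
      simp_rw [e]
      rw [← integral_sub h1 h2]
      refine integral_congr_ae ?_
      filter_upwards [ae_unitMeas_mem] with t ht
      have hm : x - t ∈ Iic (1 - h) := by
        have := add_half_pow_lt_one hl hx
        have := ht.1
        simp only [mem_Iic]; linarith
      rw [diffKer, indicator_of_mem hm, mul_sub]
    · rw [indicator_of_notMem hx, indicator_of_notMem hx]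
  have hM : MemLp (fracDiff lam D l) 2 volume :=
    (memLp_congr_ae hae).2 (hY.1.indicator (measurableSet_leftHalves l))
  refine ⟨hM.mono_measure unitMeas_le_volume, ?_⟩
  refine (integral_mono_measure unitMeas_le_volume (Eventually.of_forall fun _ => sq_nonneg _)
    hM.integrable_sq).trans (le_trans ?_ hY.2)
  refine integral_mono_ae hM.integrable_sq hY.1.integrable_sq ?_
  filter_upwards [hae] with x hx
  rw [hx]
  by_cases hx' : x ∈ leftHalves l
  · rw [indicator_of_mem hx']
  · rw [indicator_of_notMem hx']
    simp only [ne_eq, OfNat.ofNat_ne_zero, not_false_eq_true, zero_pow]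
    exact sq_nonneg _

/-- With the `α` largest bits fixed, the primitives share the factor `T`. After passing to
differences, the integrals are Walsh coefficients of the single function `fracDiff lam D l * T`. -/
lemma bessel_walPrim_fiber {lam : ℝ} (hlam : 0 < lam) {D : ℝ → ℝ} (hD : MemLp D 2 unitMeas)
    {α l : ℕ} (hl : 1 ≤ l) (p : Fin α → ℕ) {S : Finset ℕ} (hS : ∀ k ∈ S, topBit k α = l)
    (hp : ∀ k ∈ S, (fun i : Fin α => topBit k i) = p) :
    ∑ k ∈ S, (∫ x, fracInt lam D x * walPrim k α x ∂unitMeas) ^ 2 ≤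
      (∏ i, (1 / 4 : ℝ) ^ p i) * ((∫ y, |diffKer lam ((1 / 2) ^ l) y|) ^ 2 *
        ∫ t, D t ^ 2 ∂unitMeas) := by
  have hR0 : 0 ≤ (∏ i, (1 / 4 : ℝ) ^ p i) * ((∫ y, |diffKer lam ((1 / 2) ^ l) y|) ^ 2 *
      ∫ t, D t ^ 2 ∂unitMeas) := by
    refine mul_nonneg (Finset.prod_nonneg fun _ _ => by positivity) (mul_nonneg (sq_nonneg _) ?_)
    exact integral_nonneg fun _ => sq_nonneg _
  rcases S.eq_empty_or_nonempty with rfl | ⟨k0, hk0⟩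
  · simpa using hR0
  have hne : ∀ k ∈ S, topBit k α ≠ 0 := fun k hk => by rw [hS k hk]; omega
  have hne' : ∀ k ∈ S, ∀ i < α, topBit k i ≠ 0 := fun k hk i hi =>
    topBit_ne_zero_of_le hi.le (hne k hk)
  have htop : ∀ k ∈ S, ∀ i < α, topBit k i = topBit k0 i := fun k hk i hi =>
    congrFun ((hp k hk).trans (hp k0 hk0).symm) ⟨i, hi⟩
  obtain ⟨hTm, hTp, hTb⟩ :=
    iterPrim_measurable_bounded _ α (topBit_strictAnti (hne' k0 hk0))
  set T := iterPrim (topBit k0) α with hT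
  set C := ∏ i ∈ Finset.range α, (1 / 2 : ℝ) ^ topBit k0 i with hC
  have hTper : Function.Periodic T ((1 / 2) ^ l) :=
    hTp l fun i hi => by rw [← hS k0 hk0]; exact topBit_lt hi (hne k0 hk0)
  obtain ⟨hdL, hdsq⟩ := fracDiff_memLp_and_sq_le hlam hD hl
  have hint : ∀ k ∈ S, ∫ x, fracInt lam D x * walPrim k α x ∂unitMeas =
      ∫ x, (fracDiff lam D l x * T x) * radProd (remBits k (α + 1)) x ∂unitMeas := by
    intro k hk
    have hw : walPrim k α = fun x => T x * radProd (insert l (remBits k (α + 1))) x := by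
      ext x
      rw [walPrim, remBits_eq_insert (hne k hk), hS k hk, iterPrim_congr (htop k hk)]
    rw [hw]
    exact integral_mul_radProd_insert hl (fun c hc => by
      rw [← hS k hk]; exact lt_topBit_of_mem_remBits (hne k hk) hc)
      (fracInt_integrable hlam hD) hTm hTb hTper
  have hdT : MemLp (fun x => fracDiff lam D l x * T x) 2 unitMeas := by
    have : MemLp (fun x => T x * fracDiff lam D l x) 2 unitMeas :=
      hdL.of_le_mul (c := C) (hTm.aestronglyMeasurable.mul hdL.1)
        (Eventually.of_forall fun x => by
          rw [norm_mul]; exact mul_le_mul_of_nonneg_right (hTb x) (norm_nonneg _))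
    simpa only [mul_comm] using this
  rw [Finset.sum_congr rfl fun k hk => by rw [hint k hk]]
  refine (bessel_radProd (R := fun k => remBits k (α + 1)) ?_ ?_ hdT).trans ?_
  · intro k hk k' hk' h
    refine eq_of_remBits_eq (n := α + 1) (fun i hi => ?_) (fun i hi => ?_) h
    · exact topBit_ne_zero_of_le (by omega : i ≤ α) (hne k hk)
    · rcases Nat.lt_succ_iff_lt_or_eq.1 hi with hi | rfl
      · rw [htop k hk i hi, htop k' hk' i hi]
      · rw [hS k hk, hS k' hk']
  · exact fun k _ b hb => one_le_of_mem_bitSet (remBits_subset k _ hb)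
  · have hC2 : ∏ i, (1 / 4 : ℝ) ^ p i = C ^ 2 := by
      rw [← hp k0 hk0, hC, ← Finset.prod_pow, Finset.prod_range]
      refine Finset.prod_congr rfl fun i _ => ?_
      rw [← pow_mul, mul_comm, pow_mul]; norm_num
    have h1 : ∫ x, (fracDiff lam D l x * T x) ^ 2 ∂unitMeas ≤
        C ^ 2 * ∫ x, fracDiff lam D l x ^ 2 ∂unitMeas := by
      rw [← integral_const_mul]
      refine integral_mono hdT.integrable_sq (hdL.integrable_sq.const_mul _) fun x => ?_
      have h2 : T x ^ 2 ≤ C ^ 2 := sq_le_sq' (by linarith [abs_le.1 (hTb x)])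
        (abs_le.1 (hTb x)).2
      simp only
      rw [mul_pow, mul_comm]
      exact mul_le_mul_of_nonneg_right h2 (sq_nonneg _)
    rw [hC2]
    exact h1.trans (mul_le_mul_of_nonneg_left hdsq (sq_nonneg _))

lemma sum_quarter_pow_le (l N : ℕ) : ∑ b ∈ Finset.Ioc l N, (1 / 4 : ℝ) ^ b ≤ (1 / 4) ^ l := by
  -- Subtracting `(1/4)^N` strengthens the claim enough for induction.
  have h : ∀ N, l ≤ N → ∑ b ∈ Finset.Ioc l N, (1 / 4 : ℝ) ^ b ≤ (1 / 4) ^ l - (1 / 4) ^ N := by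
    intro N hN
    induction N, hN using Nat.le_induction with
    | base => simp
    | succ N hN ih =>
      rw [Finset.sum_Ioc_succ_top hN, pow_succ]
      have : (0 : ℝ) < (1 / 4) ^ N := by positivity
      linarith
  rcases le_or_gt l N with hN | hN
  · have : (0 : ℝ) < (1 / 4) ^ N := by positivity
    linarith [h N hN]
  · rw [Finset.Ioc_eq_empty (by omega)]; simp

/-- The indices are grouped by their `α` top bits. Forgetting the ordering of these bits enlarges
the sum to all tuples from `(l, N]`, which factors into a power of one geometric sum. -/
lemma bessel_walPrim {lam : ℝ} (hlam : 0 < lam) {D : ℝ → ℝ} (hD : MemLp D 2 unitMeas)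
    {α l : ℕ} (hl : 1 ≤ l) {S : Finset ℕ} (hS : ∀ k ∈ S, topBit k α = l) :
    ∑ k ∈ S, (∫ x, fracInt lam D x * walPrim k α x ∂unitMeas) ^ 2 ≤
      ((1 / 4 : ℝ) ^ l) ^ α * ((∫ y, |diffKer lam ((1 / 2) ^ l) y|) ^ 2 *
        ∫ t, D t ^ 2 ∂unitMeas) := by
  classical
  set Q := (∫ y, |diffKer lam ((1 / 2) ^ l) y|) ^ 2 * ∫ t, D t ^ 2 ∂unitMeas with hQ
  have hQ0 : 0 ≤ Q := mul_nonneg (sq_nonneg _) (integral_nonneg fun _ => sq_nonneg _)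
  set P : ℕ → Fin α → ℕ := fun k i => topBit k i with hP
  set N := S.sup fun k => topBit k 0 with hN
  have hPmem : ∀ k ∈ S, P k ∈ Fintype.piFinset fun _ : Fin α => Finset.Ioc l N := by
    intro k hk
    rw [Fintype.mem_piFinset]
    intro i
    have hne : topBit k α ≠ 0 := by rw [hS k hk]; omega
    rw [Finset.mem_Ioc]
    constructor
    · rw [← hS k hk]; exact topBit_lt i.2 hne
    · have h1 : topBit k i ≤ topBit k 0 := by
        rcases Nat.eq_zero_or_pos (i : ℕ) with h | h
        · simp only [h]; exact le_rfl
        · exact (topBit_lt h (topBit_ne_zero_of_le i.2.le hne)).le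
      exact h1.trans (Finset.le_sup (f := fun k => topBit k 0) hk)
  rw [← Finset.sum_fiberwise_of_maps_to hPmem]
  calc ∑ p ∈ Fintype.piFinset fun _ : Fin α => Finset.Ioc l N, ∑ k ∈ S with P k = p,
        (∫ x, fracInt lam D x * walPrim k α x ∂unitMeas) ^ 2
      ≤ ∑ p ∈ Fintype.piFinset fun _ : Fin α => Finset.Ioc l N, (∏ i, (1 / 4 : ℝ) ^ p i) * Q :=
        Finset.sum_le_sum fun p _ => bessel_walPrim_fiber hlam hD hl p
          (fun k hk => hS k (Finset.mem_filter.1 hk).1) fun k hk => (Finset.mem_filter.1 hk).2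
    _ = (∑ b ∈ Finset.Ioc l N, (1 / 4 : ℝ) ^ b) ^ α * Q := by
        rw [← Finset.sum_mul, ← Finset.prod_univ_sum (fun _ : Fin α => Finset.Ioc l N)
          (fun _ b => (1 / 4 : ℝ) ^ b)]
        simp
    _ ≤ ((1 / 4 : ℝ) ^ l) ^ α * Q := by
        gcongr
        exact sum_quarter_pow_le l N

/-! ### Constants -/

/-- Convexity, together with `Γ(1) = Γ(2) = 1`. -/
lemma Gamma_add_one_le_one {lam : ℝ} (h0 : 0 < lam) (h1 : lam ≤ 1) : Real.Gamma (lam + 1) ≤ 1 := by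
  have := Real.convexOn_Gamma.2 (by simp : (1 : ℝ) ∈ Ioi 0) (by simp : (2 : ℝ) ∈ Ioi 0)
    (by linarith : 0 ≤ 1 - lam) h0.le (by ring)
  simp only [smul_eq_mul, Real.Gamma_one, Real.Gamma_two] at this
  convert! this using 2 <;> ring

lemma constC_sq {lam : ℝ} (h0 : 0 < lam) (h1 : lam ≤ 1) :
    constC lam ^ 2 / 2 = (if lam < 1 then 4 else 1) * ((Real.Gamma lam)⁻¹ * (1 / lam)) ^ 2 := by
  unfold constC
  have hs : √2 ^ 2 = (2 : ℝ) := Real.sq_sqrt (by norm_num)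
  have hG := Real.Gamma_pos_of_pos h0
  split_ifs with h
  · rw [Real.Gamma_add_one h0.ne', div_pow, mul_pow, hs]
    field_simp
    norm_num
  · have : lam = 1 := le_antisymm h1 (not_lt.1 h)
    subst this
    rw [hs]; simp

/-- Needed for variables outside `u` with `ℓ_j = 0`, where the plain Bessel inequality has constant
1. -/
lemma one_le_constC_sq {lam : ℝ} (h0 : 0 < lam) (h1 : lam ≤ 1) :
    1 ≤ constC lam ^ 2 / 2 := by
  rw [constC_sq h0 h1]
  have hG := Real.Gamma_pos_of_pos h0
  have h2 := Gamma_add_one_le_one h0 h1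
  rw [Real.Gamma_add_one h0.ne'] at h2
  have h3 : (Real.Gamma lam)⁻¹ * (1 / lam) = (lam * Real.Gamma lam)⁻¹ := by
    rw [mul_inv, one_div, mul_comm]
  have h4 : 1 ≤ (Real.Gamma lam)⁻¹ * (1 / lam) := by
    rw [h3]; exact (one_le_inv₀ (by positivity)).2 h2
  have h5 : (1 : ℝ) ≤ ((Real.Gamma lam)⁻¹ * (1 / lam)) ^ 2 := one_le_pow₀ h4
  split_ifs <;> linarith

lemma Gamma_inv_sq_le_constC {lam : ℝ} (h0 : 0 < lam) (h1 : lam ≤ 1) :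
    (Real.Gamma lam)⁻¹ ^ 2 * (1 / lam) ^ 2 ≤ constC lam ^ 2 / 2 := by
  rw [constC_sq h0 h1, ← mul_pow]
  have := sq_nonneg ((Real.Gamma lam)⁻¹ * (1 / lam))
  split_ifs <;> linarith

lemma Gamma_inv_sq_mul_diffKer_le {lam h : ℝ} (h0 : 0 < lam) (h1 : lam ≤ 1) (hh : 0 < h)
    (hh1 : h ≤ 1) :
    (Real.Gamma lam)⁻¹ ^ 2 * (∫ y, |diffKer lam h y|) ^ 2 ≤ constC lam ^ 2 / 2 * (h ^ lam) ^ 2 := by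
  rw [constC_sq h0 h1, integral_abs_diffKer h0 h1 hh hh1]
  have hG := Real.Gamma_pos_of_pos h0
  split_ifs with h'
  · have h2 : (1 - h) ^ lam ≤ 1 := Real.rpow_le_one (by linarith) (by linarith) h0.le
    -- Subadditivity of the power; the sign is needed before squaring.
    have h3 : 0 ≤ (1 - h) ^ lam - 1 + h ^ lam := by
      have := Real.rpow_add_le_add_rpow (p := lam) (by linarith : 0 ≤ 1 - h) hh.le h0.le h1
      rw [sub_add_cancel, Real.one_rpow] at this
      linarith
    have h4 : 0 ≤ h ^ lam := by positivity
    have h5 : (h ^ lam + ((1 - h) ^ lam - 1 + h ^ lam)) ^ 2 ≤ (2 * h ^ lam) ^ 2 := by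
      apply pow_le_pow_left₀ <;> linarith
    have h6 : 0 ≤ (Real.Gamma lam)⁻¹ ^ 2 * (1 / lam) ^ 2 := by positivity
    calc _ = (Real.Gamma lam)⁻¹ ^ 2 * (1 / lam) ^ 2 *
          (h ^ lam + ((1 - h) ^ lam - 1 + h ^ lam)) ^ 2 := by ring
      _ ≤ (Real.Gamma lam)⁻¹ ^ 2 * (1 / lam) ^ 2 * (2 * h ^ lam) ^ 2 :=
          mul_le_mul_of_nonneg_left h5 h6
      _ = _ := by ring
  -- Here the kernel norm is exactly `h`, hence the smaller constant.
  · have : lam = 1 := le_antisymm h1 (not_lt.1 h')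
    subst this
    simp

/-! ### The Bessel inequality for the transformed kernels -/

/-- The squared one-dimensional constant. -/
noncomputable def scaleConst (α : ℕ) (lam : ℝ) (l : ℕ) : ℝ :=
  constC lam ^ 2 / 2 * ((2 : ℝ) ^ (-((α : ℝ) + lam) * (l : ℝ))) ^ 2

lemma scaleConst_nonneg (α : ℕ) (lam : ℝ) (l : ℕ) : 0 ≤ scaleConst α lam l := by
  unfold scaleConst; positivity

lemma scaleConst_eq (α : ℕ) (lam : ℝ) (l : ℕ) :
    scaleConst α lam l =
      ((1 / 4 : ℝ) ^ l) ^ α * (constC lam ^ 2 / 2 * ((((1 / 2 : ℝ) ^ l) ^ lam)) ^ 2) := by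
  have h1 : (2 : ℝ) ^ (-((α : ℝ) + lam) * (l : ℝ)) =
      ((1 / 2 : ℝ) ^ l) ^ α * ((1 / 2 : ℝ) ^ l) ^ lam := by
    have h2 : (1 / 2 : ℝ) ^ l = (2 : ℝ) ^ (-(l : ℝ)) := by
      rw [Real.rpow_neg (by norm_num), Real.rpow_natCast, one_div, inv_pow]
    rw [h2, ← Real.rpow_natCast _ α, ← Real.rpow_mul (by norm_num), ← Real.rpow_mul (by norm_num),
      ← Real.rpow_add (by norm_num)]
    congr 1; ring
  have h3 : ((1 / 4 : ℝ) ^ l) ^ α = (((1 / 2 : ℝ) ^ l) ^ α) ^ 2 := by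
    rw [← pow_mul, ← pow_mul, ← pow_mul, show (1 / 4 : ℝ) = (1 / 2) ^ 2 by norm_num, ← pow_mul]
    congr 1; ring
  rw [scaleConst, h1, h3]; ring

/-- The number of integrations by parts used for a variable whose `(α+1)`-st largest bit is `l`. -/
def ibpOrder (α l : ℕ) : ℕ := if l = 0 then 0 else α

/-- The kernel `fracKer` integrated against a Walsh primitive. -/
noncomputable def fracCoef {s : ℕ} (lam : ℝ) (u : Finset (Fin s)) (j : Fin s) (n k : ℕ)
    (t : ℝ) : ℝ :=
  ∫ x, fracKer lam u j x t * walPrim k n x ∂unitMeas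

lemma topBit_ne_zero_of_lt_ibpOrder {α l k m : ℕ} (hk : topBit k α = l)
    (hm : m < ibpOrder α l) : topBit k m ≠ 0 := by
  unfold ibpOrder at hm
  split_ifs at hm with h
  · omega
  · exact topBit_ne_zero_of_le hm.le (by rw [hk]; exact h)

/-- For `j ∈ u` the fractional integral of `D` is tested: Young's inequality is used with the full
kernel if `l = 0` and with the difference kernel otherwise. For `j ∉ u` the kernel is 1: the
primitives have mean zero if `l ≥ 1`, and if `l = 0` only the mean of `D` enters. -/
lemma besselOn_fracCoef {s α l : ℕ} {lam : ℝ} (h0 : 0 < lam) (h1 : lam ≤ 1)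
    (u : Finset (Fin s)) (j : Fin s) {S : Finset ℕ} (hS : ∀ k ∈ S, topBit k α = l) :
    BesselOn (fracCoef lam u j (ibpOrder α l)) S (scaleConst α lam l) := by
  intro D hD
  have hDsq : 0 ≤ ∫ t, D t ^ 2 ∂unitMeas := integral_nonneg fun _ => sq_nonneg _
  have hw : ∀ k ∈ S, Measurable (walPrim k (ibpOrder α l)) := fun k hk =>
    measurable_walPrim fun m hm => topBit_ne_zero_of_lt_ibpOrder (hS k hk) hm
  have hw1 : ∀ k ∈ S, ∀ x, |walPrim k (ibpOrder α l) x| ≤ 1 := fun k hk =>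
    abs_walPrim_le fun m hm => topBit_ne_zero_of_lt_ibpOrder (hS k hk) hm
  have hscale0 : l = 0 → scaleConst α lam l = constC lam ^ 2 / 2 := by
    rintro rfl; simp [scaleConst]
  by_cases hj : j ∈ u
  · simp only [fracCoef, fracKer, if_pos hj]
    rw [Finset.sum_congr rfl fun k hk => by
      rw [integral_mul_posPow_swap h0 hD (hw k hk) (hw1 k hk), mul_pow], ← Finset.mul_sum]
    by_cases hl : l = 0
    · rw [hscale0 hl]
      simp only [ibpOrder, if_pos hl]
      have h2 := (bessel_walPrim_zero S (fracInt_memLp h0 hD)).trans (integral_fracInt_sq_le h0 hD)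
      calc _ ≤ (Real.Gamma lam)⁻¹ ^ 2 * ((1 / lam) ^ 2 * ∫ t, D t ^ 2 ∂unitMeas) :=
            mul_le_mul_of_nonneg_left h2 (sq_nonneg _)
        _ = ((Real.Gamma lam)⁻¹ ^ 2 * (1 / lam) ^ 2) * ∫ t, D t ^ 2 ∂unitMeas := by ring
        _ ≤ _ := mul_le_mul_of_nonneg_right (Gamma_inv_sq_le_constC h0 h1) hDsq
    · simp only [ibpOrder, if_neg hl]
      have h2 := bessel_walPrim h0 hD (Nat.one_le_iff_ne_zero.2 hl) hS
      have h3 := Gamma_inv_sq_mul_diffKer_le (h := (1 / 2) ^ l) h0 h1 (by positivity)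
        (pow_le_one₀ (by norm_num) (by norm_num))
      calc _ ≤ (Real.Gamma lam)⁻¹ ^ 2 * (((1 / 4 : ℝ) ^ l) ^ α *
            ((∫ y, |diffKer lam ((1 / 2) ^ l) y|) ^ 2 * ∫ t, D t ^ 2 ∂unitMeas)) :=
            mul_le_mul_of_nonneg_left h2 (sq_nonneg _)
        _ = ((1 / 4 : ℝ) ^ l) ^ α * ((Real.Gamma lam)⁻¹ ^ 2 *
            (∫ y, |diffKer lam ((1 / 2) ^ l) y|) ^ 2) * ∫ t, D t ^ 2 ∂unitMeas := by ring
        _ ≤ ((1 / 4 : ℝ) ^ l) ^ α * (constC lam ^ 2 / 2 * (((1 / 2 : ℝ) ^ l) ^ lam) ^ 2) *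
            ∫ t, D t ^ 2 ∂unitMeas := by gcongr
        _ = _ := by rw [scaleConst_eq]
  · simp only [fracCoef, fracKer, if_neg hj, one_mul]
    by_cases hl : l = 0
    · rw [hscale0 hl]
      simp only [ibpOrder, if_pos hl, integral_mul_const, mul_pow]
      rw [← Finset.mul_sum]
      have h2 := bessel_walPrim_zero S (memLp_const (1 : ℝ) (p := 2) (μ := unitMeas))
      simp only [one_mul, one_pow, integral_const, probReal_univ, smul_eq_mul, mul_one] at h2
      calc _ ≤ (∫ t, D t ∂unitMeas) ^ 2 * 1 := mul_le_mul_of_nonneg_left h2 (sq_nonneg _)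
        _ ≤ 1 * ∫ t, D t ^ 2 ∂unitMeas := by
            rw [mul_one, one_mul]; exact sq_integral_le hD
        _ ≤ _ := mul_le_mul_of_nonneg_right (one_le_constC_sq h0 h1) hDsq
    · rw [Finset.sum_eq_zero]
      · exact mul_nonneg (scaleConst_nonneg _ _ _) hDsq
      · intro k hk
        simp only [ibpOrder, if_neg hl]
        rw [integral_walPrim_eq_zero (by rw [hS k hk]; exact hl)]
        simp

lemma measurable_fracCoef {s : ℕ} (lam : ℝ) (u : Finset (Fin s)) (j : Fin s) {n k : ℕ}
    (h : ∀ i < n, topBit k i ≠ 0) : Measurable (fracCoef lam u j n k) := by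
  refine (StronglyMeasurable.integral_prod_left
    (f := fun x t => fracKer lam u j x t * walPrim k n x) ?_).measurable
  exact ((measurable_fracKer lam u j).mul
    ((measurable_walPrim h).comp measurable_fst)).stronglyMeasurable

lemma fracCoef_bounded {s : ℕ} {lam : ℝ} (h0 : 0 < lam) (h1 : lam ≤ 1) (u : Finset (Fin s))
    (j : Fin s) {n k : ℕ} (h : ∀ i < n, topBit k i ≠ 0) :
    ∃ C, ∀ t, |fracCoef lam u j n k t| ≤ C := by
  have hG := Real.Gamma_pos_of_pos h0
  refine ⟨(Real.Gamma lam)⁻¹ * (1 / lam + 1) + 1, fun t => ?_⟩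
  -- The bound must hold for all real `t`. Where `x - t > 1` the exponent `lam - 1 ≤ 0` gives
  -- `posPow ≤ 1`, hence the inner `+ 1`; the outer one covers `j ∉ u`.
  set F : ℝ → ℝ := fun x => (Real.Gamma lam)⁻¹ * (|truncPow lam (x - t)| + 1) + 1 with hF
  have hi := (integrable_conv_right (integrable_truncPow h0) t).abs
  have hFi : Integrable F unitMeas :=
    ((hi.add (integrable_const 1)).const_mul _).add (integrable_const 1)
  have hle : ∀ x, |fracKer lam u j x t * walPrim k n x| ≤ F x := by
    intro x
    have h2 : posPow lam (x - t) ≤ |truncPow lam (x - t)| + 1 := by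
      rcases le_or_gt (x - t) 1 with h | h
      · rw [posPow_eq_truncPow lam h]
        linarith [le_abs_self (truncPow lam (x - t))]
      · have : posPow lam (x - t) ≤ 1 := by
          unfold posPow
          rw [if_pos (by linarith)]
          exact Real.rpow_le_one_of_one_le_of_nonpos h.le (by linarith)
        linarith [abs_nonneg (truncPow lam (x - t))]
    have h3 : fracKer lam u j x t ≤ F x := by
      have h4 : 0 ≤ (Real.Gamma lam)⁻¹ := by positivity
      have h5 := abs_nonneg (truncPow lam (x - t))
      unfold fracKer
      simp only [hF]
      split_ifs <;> nlinarith
    rw [abs_mul, abs_of_nonneg (fracKer_nonneg h0 u j x t)]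
    have h4 := abs_walPrim_le h x
    have h5 := fracKer_nonneg h0 u j x t
    nlinarith [abs_nonneg (walPrim k n x)]
  have hb : |fracCoef lam u j n k t| ≤ ∫ x, F x ∂unitMeas := by
    exact norm_integral_le_of_norm_le (f := fun x => fracKer lam u j x t * walPrim k n x) hFi
      (Eventually.of_forall hle)
  refine hb.trans ?_
  have e : ∫ x, F x ∂unitMeas =
      (Real.Gamma lam)⁻¹ * (∫ x, |truncPow lam (x - t)| ∂unitMeas + 1) + 1 := by
    simp only [hF]
    have i1 : Integrable (fun x => (Real.Gamma lam)⁻¹ * (|truncPow lam (x - t)| + 1)) unitMeas :=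
      (hi.add (integrable_const 1)).const_mul _
    rw [integral_add i1 (integrable_const 1), integral_const_mul,
      integral_add hi (integrable_const 1)]
    simp
  rw [e, ← integral_truncPow h0]
  have := integral_abs_conv_right_le (integrable_truncPow h0) t
  have h4 : 0 ≤ (Real.Gamma lam)⁻¹ := by positivity
  nlinarith

/-! ### The multivariate estimate -/

lemma exists_isFracDeriv_of_fracNorm_lt_top {s : ℕ} {lam : ℝ} {g : (Fin s → ℝ) → ℝ}
    (h : fracNorm lam g < ⊤) :
    ∃ D, ∃ p : ℝ≥0∞, 2 ≤ p ∧ ENNReal.ofReal lam⁻¹ < p ∧ IsFracDeriv lam p g D := by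
  simp only [fracNorm, iInf_lt_iff] at h
  obtain ⟨D, hD, _⟩ := h
  exact ⟨D, hD⟩

lemma hasMixedDerivs_of_sobolevNorm_lt_top {s α : ℕ} {lam : ℝ} {f : (Fin s → ℝ) → ℝ}
    (h : sobolevNorm α lam f < ⊤) : HasMixedDerivs f α := by
  by_contra h'
  simp [sobolevNorm, h'] at h

lemma fracNorm_le_sobolevNorm {s α : ℕ} (lam : ℝ) (f : (Fin s → ℝ) → ℝ)
    {a : Fin s → ℕ} (ha : ∀ i, a i ≤ α) : fracNorm lam (mixedDeriv f a) ≤ sobolevNorm α lam f := by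
  classical
  unfold sobolevNorm
  split_ifs with h
  · have hmem : a ∈ Fintype.piFinset fun _ : Fin s => Finset.range (α + 1) :=
      Fintype.mem_piFinset.2 fun i => Finset.mem_range.2 (Nat.lt_succ_of_le (ha i))
    have h1 := Finset.single_le_sum (f := fun a => fracNorm lam (mixedDeriv f a) ^ 2)
      (fun _ _ => zero_le) hmem
    calc fracNorm lam (mixedDeriv f a) = (fracNorm lam (mixedDeriv f a) ^ 2) ^ (1 / 2 : ℝ) := by
          rw [← ENNReal.rpow_natCast, ← ENNReal.rpow_mul]; norm_num
      _ ≤ _ := ENNReal.rpow_le_rpow h1 (by norm_num)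
  · exact le_top

lemma IsFracDeriv.familyNorm_eq {s : ℕ} {lam : ℝ} {p : ℝ≥0∞} (hp : 2 ≤ p) {g : (Fin s → ℝ) → ℝ}
    {D : (u : Finset (Fin s)) → (u → ℝ) → ℝ} (h : IsFracDeriv lam p g D) :
    familyNorm D = ENNReal.ofReal √(∑ u : Finset (Fin s),
      ∫ t : Fin s → ℝ, (D u fun i => t i) ^ 2 ∂(Measure.pi fun _ => unitMeas)) := by
  have hu : ∀ u, eLpNorm (D u) 2 (volume.restrict (Icc (0 : u → ℝ) 1)) ^ 2 =
      ENNReal.ofReal (∫ t : Fin s → ℝ, (D u fun i => t i) ^ 2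
        ∂(Measure.pi fun _ => unitMeas)) := by
    intro u
    have h1 := (h.memLp_cube u).mono_exponent hp
    have hm := (h.memLp u).1
    rw [cube_eq_pi] at hm ⊢
    rw [← eLpNorm_comp_measurePreserving hm (measurePreserving_restrict_cube u)]
    have h2 := h1.eLpNorm_eq_integral_rpow_norm two_ne_zero ENNReal.ofNat_ne_top
    have h0 : 0 ≤ ∫ t : Fin s → ℝ, (D u fun i => t i) ^ 2 ∂(Measure.pi fun _ => unitMeas) :=
      integral_nonneg fun _ => sq_nonneg _
    have h3 : eLpNorm (D u ∘ fun (x : Fin s → ℝ) (i : u) => x i) 2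
        (Measure.pi fun _ => unitMeas) = ENNReal.ofReal √(∫ t : Fin s → ℝ, (D u fun i => t i) ^ 2
          ∂(Measure.pi fun _ => unitMeas)) := by
      rw [Real.sqrt_eq_rpow]
      exact h2.trans (by simp)
    rw [h3, ← ENNReal.ofReal_pow (Real.sqrt_nonneg _), Real.sq_sqrt h0]
  unfold familyNorm
  rw [Finset.sum_congr rfl fun u _ => hu u, ← ENNReal.ofReal_sum_of_nonneg fun u _ =>
    integral_nonneg fun _ => sq_nonneg _, ENNReal.ofReal_rpow_of_nonneg
    (Finset.sum_nonneg fun u _ => integral_nonneg fun _ => sq_nonneg _) (by norm_num),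
    Real.sqrt_eq_rpow]

lemma IsFracDeriv.integral_mul_walPrim {s : ℕ} {lam : ℝ} (h0 : 0 < lam) {p : ℝ≥0∞} (hp : 2 ≤ p)
    {g : (Fin s → ℝ) → ℝ} {D : (u : Finset (Fin s)) → (u → ℝ) → ℝ} (h : IsFracDeriv lam p g D)
    {k a : Fin s → ℕ} (hk : ∀ i, ∀ m < a i, topBit (k i) m ≠ 0) :
    ∫ x, g x * ∏ i, walPrim (k i) (a i) (x i) ∂(Measure.pi fun _ => unitMeas) =
      ∑ u : Finset (Fin s), ∫ t : Fin s → ℝ, (D u fun i => t i) *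
        ∏ j, fracCoef lam u j (a j) (k j) (t j) ∂(Measure.pi fun _ => unitMeas) := by
  have hw := fun i => measurable_walPrim (hk i)
  have hw1 := fun i => abs_walPrim_le (hk i)
  have hD : ∀ u, Integrable (fun t : Fin s → ℝ => D u fun i => t i)
      (Measure.pi fun _ => unitMeas) := fun u =>
    (h.memLp_cube u).integrable (one_le_two.trans hp)
  have key := fun u => integral_prod_kernel_mul (fun j => isKernelOn_fracKer h0 u j) hw hw1 (hD u)
  have e : ∫ x, g x * ∏ i, walPrim (k i) (a i) (x i) ∂(Measure.pi fun _ => unitMeas) =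
      ∫ x, ∑ u : Finset (Fin s), (∫ t : Fin s → ℝ, (D u fun i => t i) *
        ∏ j, fracKer lam u j (x j) (t j) ∂(Measure.pi fun _ => unitMeas)) *
        ∏ i, walPrim (k i) (a i) (x i) ∂(Measure.pi fun _ => unitMeas) := by
    refine integral_congr_ae ?_
    filter_upwards [ae_cube_mem (Fin s)] with x hx
    rw [h.eq_sum hx, Finset.sum_mul]
  rw [e, integral_finsetSum _ fun u _ => (key u).1]
  exact Finset.sum_congr rfl fun u _ => (key u).2

/-- The `2^s` from Cauchy–Schwarz over the sets `u` cancels the factor `1/2` in each `scaleConst`.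
-/
lemma two_pow_mul_prod_scaleConst {s : ℕ} (α : ℕ) (lam : ℝ) (ℓ : Fin s → ℕ) :
    2 ^ s * ∏ j, scaleConst α lam (ℓ j) =
      (constC lam ^ s * (2 : ℝ) ^ (-((α : ℝ) + lam) * ((∑ j, ℓ j : ℕ) : ℝ))) ^ 2 := by
  have h1 : (2 : ℝ) ^ (-((α : ℝ) + lam) * ((∑ j, ℓ j : ℕ) : ℝ)) =
      ∏ j, (2 : ℝ) ^ (-((α : ℝ) + lam) * (ℓ j : ℝ)) := by
    rw [← Real.rpow_sum_of_pos (by norm_num), ← Finset.mul_sum]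
    push_cast
    rfl
  rw [h1, mul_pow, ← Finset.prod_pow]
  simp only [scaleConst]
  rw [Finset.prod_mul_distrib, Finset.prod_const, Finset.card_univ, Fintype.card_fin, ← mul_assoc,
    ← mul_pow, ← pow_mul, mul_comm s 2, pow_mul]
  congr 2
  ring

/-- The estimate for finitely many Walsh coefficients in a block. -/
lemma sum_sq_walshCoeff_le {s α : ℕ} {lam : ℝ} (h0 : 0 < lam) (h1 : lam ≤ 1)
    {f : (Fin s → ℝ) → ℝ} (hf : HasMixedDerivs f α)
    (hbm : ∀ a : Fin s → ℕ, (∀ i, a i ≤ α) → BddMeasOnCube (mixedDeriv f a))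
    {ℓ : Fin s → ℕ} {T : Finset (Fin s → ℕ)} (hT : ∀ k ∈ T, ∀ j, topBit (k j) α = ℓ j)
    {p : ℝ≥0∞} (hp : 2 ≤ p) {D : (u : Finset (Fin s)) → (u → ℝ) → ℝ}
    (hD : IsFracDeriv lam p (mixedDeriv f fun j => ibpOrder α (ℓ j)) D) :
    ∑ k ∈ T, |walshCoeff f k| ^ 2 ≤
      (constC lam ^ s * (2 : ℝ) ^ (-((α : ℝ) + lam) * ((∑ j, ℓ j : ℕ) : ℝ))) ^ 2 *
        ∑ u : Finset (Fin s), ∫ t : Fin s → ℝ, (D u fun i => t i) ^ 2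
          ∂(Measure.pi fun _ => unitMeas) := by
  classical
  set a : Fin s → ℕ := fun j => ibpOrder α (ℓ j) with ha
  have haα : ∀ i, a i ≤ α := fun i => by
    simp only [ha, ibpOrder]; split_ifs <;> omega
  -- The condition on the bits is coordinatewise, so `T` may be enlarged to a product set, as the
  -- tensor Bessel inequality requires.
  set S : Fin s → Finset ℕ := fun j => T.image fun k => k j with hS
  have hSmem : ∀ j, ∀ m ∈ S j, topBit m α = ℓ j := by
    intro j m hm
    obtain ⟨k, hk, rfl⟩ := Finset.mem_image.1 hm
    exact hT k hk j
  have hTS : T ⊆ Fintype.piFinset S := fun k hk =>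
    Fintype.mem_piFinset.2 fun j => Finset.mem_image_of_mem _ hk
  set A : Finset (Fin s) → (Fin s → ℕ) → ℝ := fun u k => ∫ t : Fin s → ℝ, (D u fun i => t i) *
    ∏ j, fracCoef lam u j (a j) (k j) (t j) ∂(Measure.pi fun _ => unitMeas) with hA
  have hne : ∀ j, ∀ m ∈ S j, ∀ i < a j, topBit m i ≠ 0 := fun j m hm i hi =>
    topBit_ne_zero_of_lt_ibpOrder (hSmem j m hm) hi
  have hcoef : ∀ k ∈ Fintype.piFinset S, |walshCoeff f k| ^ 2 ≤ 2 ^ s * ∑ u, A u k ^ 2 := by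
    intro k hk
    rw [Fintype.mem_piFinset] at hk
    have hk' : ∀ i, ∀ m < a i, topBit (k i) m ≠ 0 := fun i => hne i _ (hk i)
    rw [abs_walshCoeff_eq hf hbm a haα hk', hD.integral_mul_walPrim h0 hp hk', sq_abs]
    -- Cauchy–Schwarz over the `2^s` subsets `u`.
    refine sq_sum_le_card_mul_sum_sq.trans (le_of_eq ?_)
    simp [hA]
  have hbes : ∀ u, ∑ k ∈ Fintype.piFinset S, A u k ^ 2 ≤ (∏ j, scaleConst α lam (ℓ j)) *
      ∫ t : Fin s → ℝ, (D u fun i => t i) ^ 2 ∂(Measure.pi fun _ => unitMeas) := fun u =>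
    BesselOn.pi (φ := fun j => fracCoef lam u j (a j)) (fun j => scaleConst_nonneg _ _ _)
      (fun j k hk => measurable_fracCoef lam u j (hne j k hk))
      (fun j k hk => fracCoef_bounded h0 h1 u j (hne j k hk))
      (fun j => besselOn_fracCoef h0 h1 u j (hSmem j)) ((hD.memLp_cube u).mono_exponent hp)
  calc ∑ k ∈ T, |walshCoeff f k| ^ 2 ≤ ∑ k ∈ Fintype.piFinset S, |walshCoeff f k| ^ 2 :=
        Finset.sum_le_sum_of_subset_of_nonneg hTS fun _ _ _ => sq_nonneg _
    _ ≤ ∑ k ∈ Fintype.piFinset S, 2 ^ s * ∑ u, A u k ^ 2 := Finset.sum_le_sum hcoef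
    _ = 2 ^ s * ∑ u, ∑ k ∈ Fintype.piFinset S, A u k ^ 2 := by
        rw [← Finset.mul_sum, Finset.sum_comm]
    _ ≤ 2 ^ s * ∑ u : Finset (Fin s), (∏ j, scaleConst α lam (ℓ j)) *
          ∫ t : Fin s → ℝ, (D u fun i => t i) ^ 2 ∂(Measure.pi fun _ => unitMeas) := by
        gcongr with u _
        exact hbes u
    _ = _ := by rw [← Finset.mul_sum, ← mul_assoc, two_pow_mul_prod_scaleConst]

lemma constC_pos {lam : ℝ} (h0 : 0 < lam) : 0 < constC lam := by
  unfold constC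
  split_ifs
  · have := Real.Gamma_pos_of_pos (by linarith : 0 < lam + 1)
    positivity
  · positivity

lemma sum_sq_walshCoeff_le_sobolevNorm {s α : ℕ} {lam : ℝ} (h0 : 0 < lam) (h1 : lam ≤ 1)
    {f : (Fin s → ℝ) → ℝ} (hf : sobolevNorm α lam f < ⊤)
    {ℓ : Fin s → ℕ} {T : Finset (Fin s → ℕ)} (hT : ∀ k ∈ T, ∀ j, topBit (k j) α = ℓ j) :
    ∑ k ∈ T, |walshCoeff f k| ^ 2 ≤
      (constC lam ^ s * (sobolevNorm α lam f).toReal *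
        (2 : ℝ) ^ (-((α : ℝ) + lam) * ((∑ j, ℓ j : ℕ) : ℝ))) ^ 2 := by
  have hmd := hasMixedDerivs_of_sobolevNorm_lt_top hf
  have hbm : ∀ a : Fin s → ℕ, (∀ i, a i ≤ α) → BddMeasOnCube (mixedDeriv f a) := by
    intro a ha
    obtain ⟨D, p, hp, hlp, hD⟩ := exists_isFracDeriv_of_fracNorm_lt_top
      ((fracNorm_le_sobolevNorm lam f ha).trans_lt hf)
    exact hD.bddMeasOnCube h0 hp hlp
  set c := constC lam ^ s * (2 : ℝ) ^ (-((α : ℝ) + lam) * ((∑ j, ℓ j : ℕ) : ℝ)) with hc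
  have hcpos : 0 < c := mul_pos (pow_pos (constC_pos h0) _) (by positivity)
  set X := ∑ k ∈ T, |walshCoeff f k| ^ 2 with hX
  -- The estimate holds for every admissible family `D`, so it passes to the infimum without appeal
  -- to uniqueness of fractional derivatives.
  have hfrac : ENNReal.ofReal (√X / c) ≤
      fracNorm lam (mixedDeriv f fun j => ibpOrder α (ℓ j)) := by
    refine le_iInf₂ fun D hD => ?_
    obtain ⟨p, hp, hlp, hD⟩ := hD
    rw [hD.familyNorm_eq hp]
    refine ENNReal.ofReal_le_ofReal ?_
    rw [div_le_iff₀ hcpos, Real.sqrt_le_iff]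
    have hY : 0 ≤ ∑ u : Finset (Fin s), ∫ t : Fin s → ℝ, (D u fun i => t i) ^ 2
        ∂(Measure.pi fun _ => unitMeas) :=
      Finset.sum_nonneg fun _ _ => integral_nonneg fun _ => sq_nonneg _
    refine ⟨by positivity, ?_⟩
    rw [mul_pow, Real.sq_sqrt hY, mul_comm]
    exact sum_sq_walshCoeff_le h0 h1 hmd hbm hT hp hD
  have hsob := hfrac.trans (fracNorm_le_sobolevNorm (α := α) lam f fun i => by
    simp only [ibpOrder]; split_ifs <;> omega)
  rw [ENNReal.ofReal_le_iff_le_toReal hf.ne, div_le_iff₀ hcpos] at hsob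
  have hX0 : 0 ≤ X := Finset.sum_nonneg fun _ _ => sq_nonneg _
  calc X = √X ^ 2 := (Real.sq_sqrt hX0).symm
    _ ≤ ((sobolevNorm α lam f).toReal * c) ^ 2 := pow_le_pow_left₀ (Real.sqrt_nonneg _) hsob 2
    _ = _ := by rw [hc]; ring

end FracWalsh

theorem mainTheorem8 (s α : ℕ) (lam : ℝ) (hlam0 : 0 < lam) (hlam1 : lam ≤ 1)
    (f : (Fin s → ℝ) → ℝ) (hf : FracWalsh.sobolevNorm α lam f < ⊤)
    (ℓ : Fin s → ℕ) (hℓ : ℓ ≠ 0) :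
    Summable (fun k : FracWalsh.block α ℓ => |FracWalsh.walshCoeff f k.1| ^ 2) ∧
      √(∑' k : FracWalsh.block α ℓ, |FracWalsh.walshCoeff f k.1| ^ 2) ≤
        FracWalsh.constC lam ^ s * (FracWalsh.sobolevNorm α lam f).toReal *
          (2 : ℝ) ^ (-((α : ℝ) + lam) * ((∑ j, ℓ j : ℕ) : ℝ)) := by
  -- A bound uniform over finite partial sums of nonnegative terms yields both convergence and the
  -- inequality.
  have hsum : ∀ T : Finset (FracWalsh.block α ℓ), ∑ k ∈ T, |FracWalsh.walshCoeff f k.1| ^ 2 ≤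
      (FracWalsh.constC lam ^ s * (FracWalsh.sobolevNorm α lam f).toReal *
        (2 : ℝ) ^ (-((α : ℝ) + lam) * ((∑ j, ℓ j : ℕ) : ℝ))) ^ 2 := by
    intro T
    have h := FracWalsh.sum_sq_walshCoeff_le_sobolevNorm (ℓ := ℓ)
      (T := T.map (Function.Embedding.subtype _)) hlam0 hlam1 hf (fun k hk j => by
        obtain ⟨k', _, rfl⟩ := Finset.mem_map.1 hk
        exact k'.2.2 j)
    rwa [Finset.sum_map] at h
  have hs := summable_of_sum_le (fun _ => sq_nonneg _) hsum
  refine ⟨hs, Real.sqrt_le_iff.2 ⟨?_, hs.tsum_le_of_sum_le hsum⟩⟩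
  have := FracWalsh.constC_pos hlam0
  positivity
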